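/- Let $N\ge 1$ and $y_1<\dots<y_N$ be real numbers. Let $\mathbb G_N$ be the set of Gelfand--Tsetlin patterns, i.e. of real arrays $\{x_i^k\}_{1\le i\le k\le N}$ with $x_i^{k+1}\le x_i^k\le x_{i+1}^{k+1}$ for $1\le i\le k<N$. For $\beta>0$, the $\beta$-corners process $\{x_i^k(\beta)\}_{1\le i\le k\le N}$ with top row $y$ is the random element of $\mathbb G_N$ with $x_i^N(\beta)=y_i$ whose remaining $N(N-1)/2$ coordinates have the probability density (with respect to Lebesgue measure, on the patterns with top row $y$) proportional to $$\prod_{k=1}^{N-1}\left[\prod_{1\le i<j\le k}(x_j^k-x_i^k)^{2-\beta}\right]\left[\prod_{a=1}^{k}\prod_{b=1}^{k+1}|x_a^k-x_b^{k+1}|^{\beta/2-1}\right];$$ the integral of this weight is positive and finite. There is a unique array $\{\tilde x_i^k\}\in\mathbb G_N$ such that, for every $k=1,\dots,N$, $\tilde x_1^k<\dots<\tilde x_k^k$ and $$\prod_{i=1}^k(z-\tilde x_i^k)=\frac1{N(N-1)\cdots(k+1)}\left(\frac{\partial}{\partial z}\right)^{N-k}\prod_{i=1}^N(z-y_i).$$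 With $\xi_1^N=\dots=\xi_N^N=0$, the function $$\exp\left(\sum_{k=1}^{N-1}\left[\sum_{1\le i<j\le k}\frac{(\xi_i^k-\xi_j^k)^2}{2(\tilde x_i^k-\tilde x_j^k)^2}-\sum_{a=1}^k\sum_{b=1}^{k+1}\frac{(\xi_a^k-\xi_b^{k+1})^2}{4(\tilde x_a^k-\tilde x_b^{k+1})^2}\right]\right)$$ of the variables $\{\xi_i^k\}_{1\le i\le k\le N-1}$ is integrable with respect to Lebesgue measure. Let $\{\xi_i^k\}_{1\le i\le k\le N}$ be the random (Gaussian) array with $\xi_i^N=0$ whose remaining coordinates have density proportional to this function. Then, as $\beta\to\infty$, the following convergences in distribution hold, jointly over all $1\le i\le k\le N$: $$x_i^k(\beta)\to\tilde x_i^k,\qquad \sqrt\beta\,\bigl(x_i^k(\beta)-\tilde x_i^k\bigr)\to\xi_i^k.$$ -/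

import Mathlib

open MeasureTheory ProbabilityTheory Filter

noncomputable section

/-- Triangular arrays `x_i^k`, `1 ≤ i ≤ k ≤ N`, of real numbers, where `N = n + 1`. Rows and
particles are numbered from `0`: the row `k : Fin (n + 1)` has the `k + 1` particles
`x k 0, …, x k k`, and the row `Fin.last n` is the top row. -/
abbrev TriangularArray (n : ℕ) : Type := (k : Fin (n + 1)) → Fin (k + 1) → ℝ

/-- The `n (n + 1) / 2 = N (N - 1) / 2` coordinates of an array below its top row. -/
abbrev LowerRows (n : ℕ) : Type := (k : Fin n) → Fin (k + 1) → ℝ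

/-- The array with the given top row `y` and the given rows `x` below it. -/
def withTopRow {n : ℕ} (y : Fin (n + 1) → ℝ) (x : LowerRows n) : TriangularArray n :=
  Fin.snoc (α := fun k : Fin (n + 1) => Fin (k + 1) → ℝ) x y

/-- Gelfand--Tsetlin patterns: arrays with interlacing rows,
`x_i^{k+1} ≤ x_i^k ≤ x_{i+1}^{k+1}`. -/
def IsGelfandTsetlin {n : ℕ} (x : TriangularArray n) : Prop :=
  ∀ (k : Fin n) (i : Fin (k + 1)),
    x k.succ i.castSucc ≤ x k.castSucc i ∧ x k.castSucc i ≤ x k.succ i.succ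

/-- The unnormalized density of the `β`-corners process on Gelfand--Tsetlin patterns: the product
over all rows `k` below the top row of `∏_{i<j} (x_j^k - x_i^k)^{2-β}` and
`∏_{a,b} |x_a^k - x_b^{k+1}|^{β/2-1}`. -/
def cornersWeight {n : ℕ} (β : ℝ) (x : TriangularArray n) : ℝ :=
  ∏ k : Fin n,
    (∏ i : Fin (k + 1), ∏ j ∈ Finset.Ioi i, (x k.castSucc j - x k.castSucc i) ^ (2 - β)) *
      ∏ a : Fin (k + 1), ∏ b : Fin (k + 2), |x k.castSucc a - x k.succ b| ^ (β / 2 - 1)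

/-- The measure on the rows below the top row `y` whose density with respect to Lebesgue measure
is `cornersWeight` on the Gelfand--Tsetlin patterns with top row `y`, and zero elsewhere. -/
def cornersLowerMeasure {n : ℕ} (β : ℝ) (y : Fin (n + 1) → ℝ) : Measure (LowerRows n) :=
  (volume : Measure (LowerRows n)).withDensity
    ({x | IsGelfandTsetlin (withTopRow y x)}.indicator
      fun x => ENNReal.ofReal (cornersWeight β (withTopRow y x)))

/-- The law of the `β`-corners process with top row `y`: the top row is `y`, and the rows below it
have the density `cornersWeight`, divided by its total mass. -/
def betaCorners {n : ℕ} (β : ℝ) (y : Fin (n + 1) → ℝ) : Measure (TriangularArray n) :=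
  ((cornersLowerMeasure β y Set.univ)⁻¹ • cornersLowerMeasure β y).map (withTopRow y)

open Polynomial in
/-- `x` is the deterministic part of the `∞`-corners process with top row `y`: a Gelfand--Tsetlin
pattern whose row of length `m`, for every `m = 1, …, N`, is strictly increasing and consists of
the roots of the `(N - m)`-th derivative of `∏ (z - y_i)`, divided by `N (N - 1) ⋯ (m + 1)`.
(The row `k` has length `m = k + 1`, and `N = n + 1`.) -/
structure IsInfinityCorners {n : ℕ} (y : Fin (n + 1) → ℝ) (x : TriangularArray n) : Prop where
  gelfandTsetlin : IsGelfandTsetlin x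
  strictMono : ∀ k, StrictMono (x k)
  prod_eq : ∀ k : Fin (n + 1),
    ∏ i : Fin (k + 1), (X - C (x k i)) =
      C (1 / ∏ j ∈ Finset.Icc ((k : ℕ) + 2) (n + 1), (j : ℝ)) *
        derivative^[n - k] (∏ i : Fin (n + 1), (X - C (y i)))

/-- The exponent of the density of the discrete Gaussian free field on the array `x`. -/
def gffExponent {n : ℕ} (x ξ : TriangularArray n) : ℝ :=
  ∑ k : Fin n,
    ((∑ i : Fin (k + 1), ∑ j ∈ Finset.Ioi i,
        (ξ k.castSucc i - ξ k.castSucc j) ^ 2 /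
          (2 * (x k.castSucc i - x k.castSucc j) ^ 2)) -
      ∑ a : Fin (k + 1), ∑ b : Fin (k + 2),
        (ξ k.castSucc a - ξ k.succ b) ^ 2 /
          (4 * (x k.castSucc a - x k.succ b) ^ 2))

/-- The unnormalized density of the discrete Gaussian free field, as a function of the coordinates
below the top row; the coordinates in the top row are zero. -/
def gffWeight {n : ℕ} (x : TriangularArray n) (ξ : LowerRows n) : ℝ :=
  Real.exp (gffExponent x (withTopRow 0 ξ))

/-- The measure with density `gffWeight` on the coordinates below the top row. -/
def gffLowerMeasure {n : ℕ} (x : TriangularArray n) : Measure (LowerRows n) :=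
  (volume : Measure (LowerRows n)).withDensity fun ξ => ENNReal.ofReal (gffWeight x ξ)

/-- The law of the discrete Gaussian free field on the array `x`: the top row is zero, and the
coordinates below it have the density `gffWeight`, divided by its total mass. -/
def discreteGFF {n : ℕ} (x : TriangularArray n) : Measure (TriangularArray n) :=
  ((gffLowerMeasure x Set.univ)⁻¹ • gffLowerMeasure x).map (withTopRow 0)

end

/-! For strictly interlacing adjacent rows `x`, `X`, the residues w_b of ∏ (z - x_a) / ∏ (z - X_c)
at the points X_b (`rowWeight`) are positive and sum to one, and ∑_b log w_b = `logCross x X` - 2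
`logGap X`. Because 2 - β = -2 (β/2 - 1), the corners density telescopes over the rows: up to a
factor depending only on β and the top row, it is the product of all w_b ^ (β/2 - 1)
(`StrictPattern.logPotential_eq`). By AM-GM this is largest for β > 2 when the residues of each pair
of rows are equal, that is, when each row consists of the critical points of the polynomial of the
row above.

The maximum is quadratically nondegenerate, globally on the patterns. Strong concavity of the
logarithm bounds the loss of potential below by the squared deviations of the residues, and a
Lipschitz estimate carried down from the fixed top row (`StrictInterlace.exists_abs_sub_le`) bounds
the displacement of the particles by those deviations. Together they give
`CriticalRows.exists_logPotential_sub_le`.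

The rest is Laplace's method. In the coordinates x = x̃ + ξ / √β the density relative to its value
at x̃ lies below a fixed Gaussian for β ≥ 4, and it converges pointwise to `gffWeight`: the linear
term of the expansion vanishes at a maximum, and the quadratic term is the Gaussian exponent.
Dominated convergence gives both limits in distribution, and the same bound makes `gffWeight`
integrable.

Finiteness of the total mass for every β > 0 is a separate matter. It follows by integrating out one
row at a time with an upper bound of Dixon-Anderson type (`exists_lintegral_interlace_le`). -/

/-! ### Interlacing rows and their residues -/

/-- The row `x` strictly interlaces with the longer row `X` above it. -/
def StrictInterlace {m : ℕ} (x : Fin (m + 1) → ℝ) (X : Fin (m + 2) → ℝ) : Prop :=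
  ∀ i, X i.castSucc < x i ∧ x i < X i.succ

/-- The residue of `∏ (z - x_a) / ∏ (z - X_c)` at `z = X_b`. -/
noncomputable def rowWeight {m : ℕ} (x : Fin (m + 1) → ℝ) (X : Fin (m + 2) → ℝ)
    (b : Fin (m + 2)) : ℝ :=
  ∏ a, (X b - x a) / (X b - X (b.succAbove a))

/-- The logarithm of the Vandermonde product of a row. -/
noncomputable def logGap {m : ℕ} (x : Fin (m + 1) → ℝ) : ℝ :=
  ∑ i, ∑ j ∈ Finset.Ioi i, Real.log (x j - x i)

/-- The logarithm of the product of the distances between two adjacent rows. -/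
noncomputable def logCross {m : ℕ} (x : Fin (m + 1) → ℝ) (X : Fin (m + 2) → ℝ) : ℝ :=
  ∑ a, ∑ b, Real.log |x a - X b|

namespace StrictInterlace

variable {m : ℕ} {x : Fin (m + 1) → ℝ} {X : Fin (m + 2) → ℝ}

theorem lower_strictMono (h : StrictInterlace x X) : StrictMono x := by
  rw [Fin.strictMono_iff_lt_succ]
  intro i
  exact (h i.castSucc).2.trans (h i.succ).1

theorem upper_strictMono (h : StrictInterlace x X) : StrictMono X := by
  rw [Fin.strictMono_iff_lt_succ]
  intro i
  exact (h i).1.trans (h i).2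

theorem lt_of_le_castSucc (h : StrictInterlace x X) {a : Fin (m + 1)} {b : Fin (m + 2)}
    (hab : b ≤ a.castSucc) : X b < x a :=
  (h.upper_strictMono.monotone hab).trans_lt (h a).1

theorem lt_of_succ_le (h : StrictInterlace x X) {a : Fin (m + 1)} {b : Fin (m + 2)}
    (hab : a.succ ≤ b) : x a < X b :=
  (h a).2.trans_le (h.upper_strictMono.monotone hab)

theorem ne (h : StrictInterlace x X) (a : Fin (m + 1)) (b : Fin (m + 2)) : x a ≠ X b := by
  rcases le_or_gt b a.castSucc with hab | hab
  · exact (h.lt_of_le_castSucc hab).ne'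
  · exact (h.lt_of_succ_le (Fin.castSucc_lt_iff_succ_le.1 hab)).ne

/-- Interlacing puts `x a` and `X (b.succAbove a)` on the same side of `X b`, so numerator and
denominator have the same sign. -/
theorem ratio_pos (h : StrictInterlace x X) (a : Fin (m + 1)) (b : Fin (m + 2)) :
    0 < (X b - x a) / (X b - X (b.succAbove a)) := by
  rcases le_or_gt b a.castSucc with hab | hab
  · rw [Fin.succAbove_of_le_castSucc _ _ hab]
    have h1 := h.lt_of_le_castSucc hab
    have h2 := (h a).2
    exact div_pos_of_neg_of_neg (by linarith) (by linarith)
  · rw [Fin.succAbove_of_castSucc_lt _ _ hab]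
    have h1 := h.lt_of_succ_le (Fin.castSucc_lt_iff_succ_le.1 hab)
    have h2 := (h a).1
    exact div_pos (by linarith) (by linarith)

theorem rowWeight_pos (h : StrictInterlace x X) (b : Fin (m + 2)) : 0 < rowWeight x X b :=
  Finset.prod_pos fun a _ => h.ratio_pos a b

end StrictInterlace

theorem prod_erase_eq_prod_succAbove {M : Type*} [CommMonoid M] {m : ℕ} (b : Fin (m + 1))
    (f : Fin (m + 1) → M) : ∏ c ∈ Finset.univ.erase b, f c = ∏ a, f (b.succAbove a) := by
  rw [← Finset.prod_image (s := Finset.univ) (g := b.succAbove)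
    (fun i _ j _ hij => Fin.succAbove_right_injective hij)]
  congr 1
  ext c
  simp

/-! ### Residues through Lagrange interpolation -/

section Interpolation

open Polynomial

variable {m : ℕ} {x : Fin (m + 1) → ℝ} {X' : Fin (m + 2) → ℝ}

theorem rowWeight_eq_eval_div (x : Fin (m + 1) → ℝ) (X' : Fin (m + 2) → ℝ) (b : Fin (m + 2)) :
    rowWeight x X' b = (∏ a, (X - C (x a))).eval (X' b) /
      ∏ c ∈ Finset.univ.erase b, (X' b - X' c) := by
  rw [prod_erase_eq_prod_succAbove, rowWeight, Finset.prod_div_distrib, eval_prod]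
  simp

theorem degree_prod_X_sub_C_fin {m : ℕ} (x : Fin m → ℝ) :
    (∏ a, (X - C (x a)) : ℝ[X]).degree = m := by
  simp [degree_prod]

/-- Compare leading coefficients in the Lagrange interpolation of the monic polynomial ∏ (z - x_a)
at the nodes X'. -/
theorem sum_rowWeight (hX : Function.Injective X') : ∑ b, rowWeight x X' b = 1 := by
  simp_rw [rowWeight_eq_eval_div]
  rw [← Lagrange.leadingCoeff_eq_sum hX.injOn]
  · exact monic_prod_of_monic _ _ fun a _ => monic_X_sub_C _
  · rw [degree_prod_X_sub_C_fin]
    simp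
    norm_cast

theorem prod_sub_eq_sum_rowWeight (hX : Function.Injective X') (z : ℝ) :
    ∏ a, (z - x a) = ∑ b, rowWeight x X' b * ∏ a, (z - X' (b.succAbove a)) := by
  have h := Lagrange.eq_interpolate (s := Finset.univ) (v := X') (f := ∏ a, (X - C (x a)))
    hX.injOn (by rw [degree_prod_X_sub_C_fin]; simp; norm_cast; omega)
  have h2 := congrArg (eval z) h
  rw [eval_prod] at h2
  simp only [eval_sub, eval_X, eval_C, Lagrange.interpolate_apply, eval_finsetSum, eval_mul,
    Lagrange.basis, eval_prod, Lagrange.basisDivisor] at h2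
  rw [h2]
  refine Finset.sum_congr rfl fun b _ => ?_
  rw [prod_erase_eq_prod_succAbove, Finset.prod_mul_distrib, rowWeight, Finset.prod_div_distrib,
    Finset.prod_inv_distrib]
  ring

/-- The logarithmic derivative of a polynomial with simple roots has residue one at each root. -/
theorem rowWeight_eq_of_derivative (hX : Function.Injective X')
    (h : ∏ a, (X - C (x a)) = C (1 / ((m : ℝ) + 2)) * derivative (∏ b, (X - C (X' b))))
    (b : Fin (m + 2)) : rowWeight x X' b = 1 / ((m : ℝ) + 2) := by
  rw [rowWeight_eq_eval_div, h, eval_mul, eval_C, ← Lagrange.nodal_eq,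
    Lagrange.eval_nodal_derivative_eval_node_eq (Finset.mem_univ b), Lagrange.eval_nodal]
  refine mul_div_cancel_right₀ _ (Finset.prod_ne_zero_iff.2 fun c hc => ?_)
  exact sub_ne_zero.2 fun hbc => (Finset.ne_of_mem_erase hc) (hX hbc).symm

end Interpolation

/-- Every unordered pair of particles is counted from both of its ends. -/
theorem sum_sum_succAbove_log {m : ℕ} {X : Fin (m + 2) → ℝ} (hX : StrictMono X) :
    ∑ b, ∑ a, Real.log |X b - X (b.succAbove a)| = 2 * logGap X := by
  have h := Finset.sum_sum_Ioi_add_eq_sum_sum_off_diag (fun i j => Real.log |X i - X j|)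
  have h2 : ∀ b, ∑ a, Real.log |X b - X (b.succAbove a)| =
      ∑ j ∈ ({b}ᶜ : Finset (Fin (m + 2))), Real.log |X j - X b| := by
    intro b
    rw [← Fin.image_succAbove_univ, Finset.sum_image
      (fun i _ j _ hij => Fin.succAbove_right_injective hij)]
    exact Finset.sum_congr rfl fun a _ => by rw [abs_sub_comm]
  simp_rw [h2]
  rw [← h, logGap, Finset.mul_sum]
  refine Finset.sum_congr rfl fun i _ => ?_
  rw [Finset.mul_sum]
  refine Finset.sum_congr rfl fun j hj => ?_
  have := hX (Finset.mem_Ioi.1 hj)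
  rw [abs_sub_comm (X i), abs_of_pos (sub_pos.2 this), two_mul]

theorem StrictInterlace.sum_log_rowWeight {m : ℕ} {x : Fin (m + 1) → ℝ} {X : Fin (m + 2) → ℝ}
    (h : StrictInterlace x X) :
    ∑ b, Real.log (rowWeight x X b) = logCross x X - 2 * logGap X := by
  rw [← sum_sum_succAbove_log h.upper_strictMono, logCross, Finset.sum_comm,
    ← Finset.sum_sub_distrib]
  refine Finset.sum_congr rfl fun b _ => ?_
  rw [← Finset.sum_sub_distrib, rowWeight, Real.log_prod fun a _ => (h.ratio_pos a b).ne']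
  refine Finset.sum_congr rfl fun a _ => ?_
  have h1 : X b - x a ≠ 0 := sub_ne_zero.2 (h.ne a b).symm
  have h2 : X b - X (b.succAbove a) ≠ 0 :=
    sub_ne_zero.2 fun e => Fin.succAbove_ne b a (h.upper_strictMono.injective e).symm
  rw [Real.log_div h1 h2, Real.log_abs, Real.log_abs, ← Real.log_neg_eq_log (x a - X b), neg_sub]

/-! ### The deterministic array of critical points -/

-- Rolle's theorem gives one critical point inside each gap; these are as many as the degree of the
-- derivative, so they are all of its roots.
open Polynomial in
theorem exists_critical_row {m : ℕ} {X' : Fin (m + 2) → ℝ} (hX : StrictMono X') :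
    ∃ x : Fin (m + 1) → ℝ, StrictInterlace x X' ∧
      ∏ a, (X - C (x a)) = C (1 / ((m : ℝ) + 2)) * derivative (∏ b, (X - C (X' b))) := by
  set P : ℝ[X] := ∏ b, (X - C (X' b)) with hP
  have hroot : ∀ b, P.eval (X' b) = 0 := fun b => by
    rw [hP, eval_prod]
    exact Finset.prod_eq_zero (Finset.mem_univ b) (by simp)
  have hex : ∀ i : Fin (m + 1), ∃ c ∈ Set.Ioo (X' i.castSucc) (X' i.succ),
      (derivative P).eval c = 0 := by
    intro i
    obtain ⟨c, hc, hc'⟩ := exists_deriv_eq_zero (f := fun z => P.eval z) (hX i.castSucc_lt_succ)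
      P.continuous.continuousOn (by simp only [hroot])
    exact ⟨c, hc, by simpa using hc'⟩
  choose x hx hx' using hex
  have hint : StrictInterlace x X' := fun i => hx i
  refine ⟨x, hint, ?_⟩
  have hmon : P.Monic := monic_prod_of_monic _ _ fun a _ => monic_X_sub_C _
  have hdeg : P.natDegree = m + 2 := by
    have := degree_prod_X_sub_C_fin X'
    exact natDegree_eq_of_degree_eq_some this
  have hm : (m : ℝ) + 2 ≠ 0 := by positivity
  -- Two monic polynomials, one dividing the other and of at least the same degree, coincide; the
  -- factor 1 / (m + 2) is what makes the derivative monic.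
  have hmon' : (C (1 / ((m : ℝ) + 2)) * derivative P).Monic ∧
      (C (1 / ((m : ℝ) + 2)) * derivative P).natDegree ≤ m + 1 := by
    have hle : (C (1 / ((m : ℝ) + 2)) * derivative P).natDegree ≤ m + 1 := by
      refine (natDegree_C_mul_le _ _).trans ((natDegree_derivative_le P).trans ?_)
      omega
    refine ⟨monic_of_natDegree_le_of_coeff_eq_one (m + 1) hle ?_, hle⟩
    rw [coeff_C_mul, coeff_derivative]
    have : P.coeff (m + 1 + 1) = 1 := by
      have := hmon.coeff_natDegree
      rwa [hdeg] at this
    rw [this]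
    push_cast
    field_simp
    ring
  have hdvd : ∏ a, (X - C (x a)) ∣ C (1 / ((m : ℝ) + 2)) * derivative P := by
    refine Finset.prod_dvd_of_coprime ?_ fun a _ => ?_
    · intro a _ b _ hab
      exact pairwise_coprime_X_sub_C hint.lower_strictMono.injective hab
    · rw [dvd_iff_isRoot, IsRoot, eval_mul, hx', mul_zero]
  refine (eq_of_monic_of_dvd_of_natDegree_le (monic_prod_of_monic _ _ fun a _ => monic_X_sub_C _)
    hmon'.1 hdvd ?_).symm
  rw [natDegree_eq_of_degree_eq_some (degree_prod_X_sub_C_fin x)]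
  exact hmon'.2

open Polynomial in
theorem eq_of_prod_X_sub_C_eq {m : ℕ} {u v : Fin m → ℝ} (hu : StrictMono u) (hv : StrictMono v)
    (h : ∏ i, (X - C (u i)) = ∏ i, (X - C (v i))) : u = v := by
  rw [← hu.range_inj hv]
  ext z
  have h2 : ∀ w : Fin m → ℝ, z ∈ Set.range w ↔ (∏ i, (X - C (w i))).eval z = 0 := by
    intro w
    rw [eval_prod, Finset.prod_eq_zero_iff]
    simp [sub_eq_zero, eq_comm]
  rw [h2, h2, h]

/-- All adjacent rows of the array interlace strictly. -/
def StrictPattern {n : ℕ} (x : TriangularArray n) : Prop :=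
  ∀ k : Fin n, StrictInterlace (m := k) (x k.castSucc) (x k.succ)

/-- Each row of the array consists of the critical points of the row above it, and the top row
is `y`. -/
structure CriticalRows {n : ℕ} (y : Fin (n + 1) → ℝ) (x : TriangularArray n) : Prop where
  last : x (Fin.last n) = y
  strict : StrictPattern x
  derivative : ∀ k : Fin n,
    ∏ a : Fin (k + 1), (Polynomial.X - Polynomial.C (x k.castSucc a)) =
      Polynomial.C (1 / ((k : ℝ) + 2)) *
        Polynomial.derivative (∏ b : Fin (k + 2), (Polynomial.X - Polynomial.C (x k.succ b)))

theorem withTopRow_castSucc {n : ℕ} (y : Fin (n + 1) → ℝ) (x : LowerRows n) (k : Fin n) :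
    withTopRow y x k.castSucc = x k :=
  Fin.snoc_castSucc (α := fun k : Fin (n + 1) => Fin (k + 1) → ℝ) _ _ _

theorem withTopRow_last {n : ℕ} (y : Fin (n + 1) → ℝ) (x : LowerRows n) :
    withTopRow y x (Fin.last n) = y :=
  Fin.snoc_last (α := fun k : Fin (n + 1) => Fin (k + 1) → ℝ) _ _

theorem exists_criticalRows {n : ℕ} (y : Fin (n + 1) → ℝ) (hy : StrictMono y) :
    ∃ x : TriangularArray n, CriticalRows y x := by
  induction n with
  | zero => exact ⟨fun k => Fin.cases y (fun i => i.elim0) k, rfl, fun k => k.elim0,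
      fun k => k.elim0⟩
  | succ n ih =>
    obtain ⟨v, hv, hv'⟩ := exists_critical_row hy
    obtain ⟨x, hx⟩ := ih v hv.lower_strictMono
    have hcast : ∀ j : Fin (n + 1), withTopRow y x j.castSucc = x j := withTopRow_castSucc y x
    have hsucc : ∀ j : Fin n, withTopRow y x j.castSucc.succ = x j.succ := fun j =>
      withTopRow_castSucc y x j.succ
    have hlast : withTopRow y x (Fin.last n).succ = y := withTopRow_last y x
    refine ⟨withTopRow y x, withTopRow_last y x, fun k => ?_, fun k => ?_⟩
    · induction k using Fin.lastCases with
      | last =>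
        rw [hcast, hlast, hx.last]
        exact hv
      | cast j =>
        rw [hcast, hsucc]
        exact hx.strict j
    · induction k using Fin.lastCases with
      | last =>
        rw [hcast, hlast, hx.last]
        exact hv'
      | cast j =>
        rw [hcast, hsucc]
        exact hx.derivative j

theorem StrictPattern.row_strictMono {n : ℕ} {x : TriangularArray n} (h : StrictPattern x)
    (hl : StrictMono (x (Fin.last n))) (k : Fin (n + 1)) : StrictMono (x k) := by
  induction k using Fin.lastCases with
  | last => exact hl
  | cast j => exact (h j).lower_strictMono

section Polynomial

open Polynomial

theorem prod_Icc_eq_mul {n k : ℕ} (hk : k < n) :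
    ∏ j ∈ Finset.Icc (k + 2) (n + 1), (j : ℝ) =
      ((k : ℝ) + 2) * ∏ j ∈ Finset.Icc (k + 3) (n + 1), (j : ℝ) := by
  rw [← Finset.insert_Icc_succ_left_eq_Icc (by omega), Finset.prod_insert (by simp)]
  push_cast
  rfl

/-- This peels off one derivative, so that the description of each row by iterated derivatives of
the top polynomial matches the one-step description in `CriticalRows`. -/
theorem one_div_prod_iterate_derivative {n k : ℕ} (hk : k < n) (p : ℝ[X]) :
    C (1 / ∏ j ∈ Finset.Icc (k + 2) (n + 1), (j : ℝ)) * derivative^[n - k] p =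
      C (1 / ((k : ℝ) + 2)) * derivative
        (C (1 / ∏ j ∈ Finset.Icc (k + 3) (n + 1), (j : ℝ)) * derivative^[n - (k + 1)] p) := by
  rw [prod_Icc_eq_mul hk, derivative_C_mul, ← mul_assoc, ← C_mul, ← one_div_mul_one_div,
    ← Function.iterate_succ_apply' derivative]
  congr 3
  omega

theorem CriticalRows.isInfinityCorners {n : ℕ} {y : Fin (n + 1) → ℝ} (hy : StrictMono y)
    {x : TriangularArray n} (h : CriticalRows y x) : IsInfinityCorners y x where
  gelfandTsetlin k i := ⟨(h.strict k i).1.le, (h.strict k i).2.le⟩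
  strictMono := h.strict.row_strictMono (h.last.symm ▸ hy)
  prod_eq k := by
    induction k using Fin.reverseInduction with
    | last => simp [h.last]
    | cast j ih =>
      refine (h.derivative j).trans ?_
      refine Eq.trans ?_ (one_div_prod_iterate_derivative j.2 _).symm
      congr 2

/-- Weak interlacing becomes strict because a polynomial with simple roots shares no root with its
derivative. -/
theorem IsInfinityCorners.criticalRows {n : ℕ} {y : Fin (n + 1) → ℝ} (hy : StrictMono y)
    {x : TriangularArray n} (h : IsInfinityCorners y x) : CriticalRows y x := by
  have hlast : x (Fin.last n) = y := by
    refine eq_of_prod_X_sub_C_eq (h.strictMono (Fin.last n)) hy ?_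
    have := h.prod_eq (Fin.last n)
    simpa using this
  have hder : ∀ k : Fin n, ∏ a : Fin (k + 1), (X - C (x k.castSucc a)) =
      C (1 / ((k : ℝ) + 2)) * derivative (∏ b : Fin (k + 2), (X - C (x k.succ b))) := by
    intro k
    refine (h.prod_eq k.castSucc).trans ((one_div_prod_iterate_derivative k.2 _).trans ?_)
    congr 2
    exact (h.prod_eq k.succ).symm
  have hne : ∀ (k : Fin n) (a : Fin (k + 1)) (b : Fin (k + 2)),
      x k.castSucc a ≠ x k.succ b := by
    intro k a b hab
    have h1 := congrArg (eval (x k.castSucc a)) (hder k)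
    rw [eval_prod, Finset.prod_eq_zero (Finset.mem_univ a) (by simp), eval_mul, eval_C,
      hab] at h1
    have h2 : eval (x k.succ b) (derivative (∏ b : Fin (k + 2), (X - C (x k.succ b)))) ≠ 0 := by
      rw [← Lagrange.nodal_eq Finset.univ (fun b : Fin (k + 2) => x k.succ b),
        Lagrange.eval_nodal_derivative_eval_node_eq (Finset.mem_univ b), Lagrange.eval_nodal]
      refine Finset.prod_ne_zero_iff.2 fun c hc => sub_ne_zero.2 fun hbc => ?_
      exact (Finset.ne_of_mem_erase hc) ((h.strictMono k.succ).injective hbc).symm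
    refine mul_ne_zero ?_ h2 h1.symm
    positivity
  refine ⟨hlast, fun k i => ?_, hder⟩
  have hgt := h.gelfandTsetlin k i
  exact ⟨lt_of_le_of_ne hgt.1 (hne k i i.castSucc).symm, lt_of_le_of_ne hgt.2 (hne k i i.succ)⟩

theorem CriticalRows.unique {n : ℕ} {y : Fin (n + 1) → ℝ} (hy : StrictMono y)
    {x x' : TriangularArray n} (h : CriticalRows y x) (h' : CriticalRows y x') : x = x' := by
  funext k
  refine eq_of_prod_X_sub_C_eq (h.strict.row_strictMono (h.last.symm ▸ hy) k)
    (h'.strict.row_strictMono (h'.last.symm ▸ hy) k) ?_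
  rw [(h.isInfinityCorners hy).prod_eq, (h'.isInfinityCorners hy).prod_eq]

theorem existsUnique_isInfinityCorners {n : ℕ} (y : Fin (n + 1) → ℝ) (hy : StrictMono y) :
    ∃! x : TriangularArray n, IsInfinityCorners y x := by
  obtain ⟨x, hx⟩ := exists_criticalRows y hy
  exact ⟨x, hx.isInfinityCorners hy, fun x' hx' => (hx'.criticalRows hy).unique hy hx⟩

end Polynomial

/-! ### The potential as a sum of logarithms of residues -/

/-- The logarithm of `cornersWeight β x`, divided by `β / 2 - 1`. -/
noncomputable def logPotential {n : ℕ} (x : TriangularArray n) : ℝ :=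
  ∑ k : Fin n, (logCross (m := k) (x k.castSucc) (x k.succ) - 2 * logGap (m := k) (x k.castSucc))

/-- The residues `rowWeight`, normalized so that they equal one on critical rows. -/
noncomputable def relWeight {n : ℕ} (x : TriangularArray n) (k : Fin n) (b : Fin (k + 2)) : ℝ :=
  ((k : ℝ) + 2) * rowWeight (m := k) (x k.castSucc) (x k.succ) b

/-- The shift of index costs nothing at the bottom, since a row with a single particle has no gaps.
-/
theorem sum_logGap_succ {n : ℕ} (x : TriangularArray n) :
    ∑ k : Fin n, logGap (m := k + 1) (x k.succ) =
      ∑ k : Fin n, logGap (m := k) (x k.castSucc) + logGap (x (Fin.last n)) := by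
  have h := Fin.sum_univ_succ fun k : Fin (n + 1) => logGap (m := k) (x k)
  rw [Fin.sum_univ_castSucc] at h
  have h0 : logGap (m := ((0 : Fin (n + 1)) : ℕ)) (x 0) = 0 := by
    refine Finset.sum_eq_zero fun i _ => Finset.sum_eq_zero fun j hj => ?_
    have := Finset.mem_Ioi.1 hj
    have h1 : (j : ℕ) < 0 + 1 := j.2
    have h2 : (i : ℕ) < (j : ℕ) := this
    omega
  rw [h0, zero_add] at h
  exact h.symm

/-- Each residue sum carries the Vandermonde of the upper row, the potential that of the lower row;
summed over all rows, only the top Vandermonde remains as the difference. -/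
theorem StrictPattern.logPotential_eq {n : ℕ} {x : TriangularArray n} (h : StrictPattern x) :
    logPotential x = ∑ k : Fin n, ∑ b : Fin (k + 2), Real.log (relWeight x k b) -
      ∑ k : Fin n, ((k : ℝ) + 2) * Real.log ((k : ℝ) + 2) + 2 * logGap (x (Fin.last n)) := by
  have h1 : ∀ k : Fin n, ∑ b : Fin (k + 2), Real.log (relWeight x k b) =
      ((k : ℝ) + 2) * Real.log ((k : ℝ) + 2) +
        (logCross (m := k) (x k.castSucc) (x k.succ) - 2 * logGap (m := k + 1) (x k.succ)) := by
    intro k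
    rw [← (h k).sum_log_rowWeight]
    have h2 : ∀ b : Fin (k + 2), Real.log (relWeight x k b) = Real.log ((k : ℝ) + 2) +
        Real.log (rowWeight (m := k) (x k.castSucc) (x k.succ) b) := fun b =>
      Real.log_mul (by positivity) ((h k).rowWeight_pos b).ne'
    simp_rw [h2]
    rw [Finset.sum_add_distrib]
    simp
  simp_rw [h1]
  rw [Finset.sum_add_distrib, Finset.sum_sub_distrib, ← Finset.mul_sum, sum_logGap_succ,
    logPotential, Finset.sum_sub_distrib, ← Finset.mul_sum]
  ring

theorem CriticalRows.relWeight_eq {n : ℕ} {y : Fin (n + 1) → ℝ} {x : TriangularArray n}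
    (h : CriticalRows y x) (k : Fin n) (b : Fin (k + 2)) : relWeight x k b = 1 := by
  rw [relWeight, rowWeight_eq_of_derivative (h.strict k).upper_strictMono.injective
    (h.derivative k), mul_one_div, div_self (by positivity)]

theorem CriticalRows.logPotential_sub {n : ℕ} {y : Fin (n + 1) → ℝ} {xt x : TriangularArray n}
    (ht : CriticalRows y xt) (h : StrictPattern x) (hx : x (Fin.last n) = y) :
    logPotential x - logPotential xt =
      ∑ k : Fin n, ∑ b : Fin (k + 2), Real.log (relWeight x k b) := by
  rw [h.logPotential_eq, ht.strict.logPotential_eq, hx, ht.last]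
  simp [ht.relWeight_eq]

/-- Write log t = 2 log √t ≤ 2 (√t - 1) = t - 1 - (√t - 1)², then use (√t + 1)² ≤ 2 (t + 1). The
upper bound M on t gives a uniform quadratic gain. -/
theorem Real.log_le_sub_one_sub_sq {t M : ℝ} (ht : 0 < t) (htM : t ≤ M) :
    Real.log t ≤ t - 1 - (t - 1) ^ 2 / (2 * (M + 1)) := by
  have hs : 0 < √t := Real.sqrt_pos.2 ht
  have hst : √t ^ 2 = t := Real.sq_sqrt ht.le
  have h1 : Real.log t ≤ 2 * (√t - 1) := by
    have := Real.log_le_sub_one_of_pos hs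
    rw [Real.log_sqrt ht.le] at this
    linarith
  have h2 : (t - 1) ^ 2 / (2 * (M + 1)) ≤ (√t - 1) ^ 2 := by
    rw [div_le_iff₀ (by linarith)]
    have h3 : (t - 1) ^ 2 = (√t - 1) ^ 2 * (√t + 1) ^ 2 := by
      nth_rewrite 1 [← hst]
      ring
    rw [h3]
    refine mul_le_mul_of_nonneg_left ?_ (sq_nonneg _)
    nlinarith [sq_nonneg (√t - 1)]
  nlinarith

/-- A quantitative AM-GM: the linear terms cancel because the residues sum to one, and only the
quadratic gain survives. -/
theorem StrictInterlace.sum_log_mul_rowWeight_le {m : ℕ} {x : Fin (m + 1) → ℝ}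
    {X : Fin (m + 2) → ℝ} (h : StrictInterlace x X) :
    ∑ b, Real.log (((m : ℝ) + 2) * rowWeight x X b) ≤
      -(∑ b, (((m : ℝ) + 2) * rowWeight x X b - 1) ^ 2) / (2 * ((m : ℝ) + 3)) := by
  have hsum := sum_rowWeight (x := x) h.upper_strictMono.injective
  have hle : ∀ b, rowWeight x X b ≤ 1 := fun b => by
    rw [← hsum]
    exact Finset.single_le_sum (fun c _ => (h.rowWeight_pos c).le) (Finset.mem_univ b)
  have hlog : ∀ b, Real.log (((m : ℝ) + 2) * rowWeight x X b) ≤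
      (((m : ℝ) + 2) * rowWeight x X b - 1) -
        (((m : ℝ) + 2) * rowWeight x X b - 1) ^ 2 / (2 * ((m : ℝ) + 3)) := by
    intro b
    have hb := h.rowWeight_pos b
    -- Each residue is at most one, so the normalized residue is at most m + 2.
    have := Real.log_le_sub_one_sub_sq (t := ((m : ℝ) + 2) * rowWeight x X b) (M := m + 2)
      (by positivity) (mul_le_of_le_one_right (by positivity) (hle b))
    convert this using 4
    ring
  refine (Finset.sum_le_sum fun b _ => hlog b).trans (le_of_eq ?_)
  rw [Finset.sum_sub_distrib, Finset.sum_sub_distrib, ← Finset.mul_sum, hsum, ← Finset.sum_div]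
  simp
  ring

/-- The deviation of the normalized residues from one. -/
noncomputable def weightDeviation {n : ℕ} (x : TriangularArray n) : ℝ :=
  √(∑ k : Fin n, ∑ b : Fin (k + 2), (relWeight x k b - 1) ^ 2)

theorem sq_weightDeviation {n : ℕ} (x : TriangularArray n) :
    weightDeviation x ^ 2 = ∑ k : Fin n, ∑ b : Fin (k + 2), (relWeight x k b - 1) ^ 2 :=
  Real.sq_sqrt (Finset.sum_nonneg fun _ _ => Finset.sum_nonneg fun _ _ => sq_nonneg _)

theorem abs_rowWeight_sub_le {n : ℕ} (x : TriangularArray n) (k : Fin n) (b : Fin (k + 2)) :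
    |rowWeight (m := k) (x k.castSucc) (x k.succ) b - 1 / ((k : ℝ) + 2)| ≤ weightDeviation x := by
  have h1 : |relWeight x k b - 1| ≤ weightDeviation x := by
    refine Real.abs_le_sqrt ?_
    refine le_trans ?_ (Finset.single_le_sum
      (f := fun k : Fin n => ∑ b : Fin (k + 2), (relWeight x k b - 1) ^ 2)
      (fun _ _ => Finset.sum_nonneg fun _ _ => sq_nonneg _) (Finset.mem_univ k))
    exact Finset.single_le_sum (f := fun b : Fin (k + 2) => (relWeight x k b - 1) ^ 2)
      (fun _ _ => sq_nonneg _) (Finset.mem_univ b)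
  refine le_trans ?_ h1
  have hk : (0 : ℝ) < (k : ℝ) + 2 := by positivity
  have h2 : relWeight x k b - 1 = ((k : ℝ) + 2) *
      (rowWeight (m := k) (x k.castSucc) (x k.succ) b - 1 / ((k : ℝ) + 2)) := by
    rw [relWeight]
    field_simp
  rw [h2, abs_mul, abs_of_pos hk]
  exact le_mul_of_one_le_left (abs_nonneg _) (by linarith [(Nat.cast_nonneg k : (0 : ℝ) ≤ (k : ℕ))])

theorem CriticalRows.logPotential_sub_le {n : ℕ} {y : Fin (n + 1) → ℝ}
    {xt x : TriangularArray n} (ht : CriticalRows y xt) (h : StrictPattern x)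
    (hx : x (Fin.last n) = y) :
    logPotential x - logPotential xt ≤ -(1 / (2 * ((n : ℝ) + 3))) * weightDeviation x ^ 2 := by
  rw [ht.logPotential_sub h hx, sq_weightDeviation, Finset.mul_sum]
  refine Finset.sum_le_sum fun k _ => ((h k).sum_log_mul_rowWeight_le).trans ?_
  have hs : 0 ≤ ∑ b : Fin (k + 2), (relWeight x k b - 1) ^ 2 :=
    Finset.sum_nonneg fun _ _ => sq_nonneg _
  have hk : ((k : ℕ) : ℝ) ≤ n := by exact_mod_cast k.2.le
  rw [neg_div, neg_mul, neg_le_neg_iff, one_div_mul_eq_div]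
  exact div_le_div_of_nonneg_left hs (by positivity) (by linarith)

/-! ### Stability: the residues control the particles -/

theorem abs_prod_sub_prod_le {ι : Type*} (s : Finset ι) {f g : ι → ℝ} {B δ : ℝ} (hB : 1 ≤ B)
    (hf : ∀ i ∈ s, |f i| ≤ B) (hg : ∀ i ∈ s, |g i| ≤ B) (hδ : ∀ i ∈ s, |f i - g i| ≤ δ)
    (h0 : 0 ≤ δ) : |∏ i ∈ s, f i - ∏ i ∈ s, g i| ≤ s.card * B ^ s.card * δ := by
  classical
  induction s using Finset.induction_on with
  | empty => simp
  | insert a s ha ih =>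
    simp only [Finset.mem_insert, forall_eq_or_imp] at hf hg hδ
    have h1 := ih hf.2 hg.2 hδ.2
    have h2 : |∏ i ∈ s, g i| ≤ B ^ s.card := by
      rw [Finset.abs_prod, ← Finset.prod_const]
      exact Finset.prod_le_prod (fun _ _ => abs_nonneg _) hg.2
    rw [Finset.prod_insert ha, Finset.prod_insert ha, Finset.card_insert_of_notMem ha]
    have h3 : f a * ∏ i ∈ s, f i - g a * ∏ i ∈ s, g i =
        f a * (∏ i ∈ s, f i - ∏ i ∈ s, g i) + (f a - g a) * ∏ i ∈ s, g i := by ring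
    rw [h3]
    refine (abs_add_le _ _).trans ?_
    rw [abs_mul, abs_mul]
    have h4 := mul_le_mul hf.1 h1 (abs_nonneg _) (by linarith)
    have h5 := mul_le_mul hδ.1 h2 (abs_nonneg _) h0
    have h6 : B ^ s.card ≤ B ^ (s.card + 1) := pow_le_pow_right₀ hB (Nat.le_succ _)
    have h7 := mul_le_mul_of_nonneg_left h6 h0
    push_cast
    rw [pow_succ] at h7 ⊢
    nlinarith

/-- The margin is `2 * g` so that `g` is left over after the upper row moves by at most `g`. -/
theorem StrictInterlace.exists_gap {m : ℕ} {x : Fin (m + 1) → ℝ} {X : Fin (m + 2) → ℝ}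
    (h : StrictInterlace x X) :
    ∃ g > 0, ∀ i, X i.castSucc + 2 * g ≤ x i ∧ x i + 2 * g ≤ X i.succ := by
  have h1 : ∀ᶠ g : ℝ in nhdsWithin 0 (Set.Ioi 0),
      ∀ i, X i.castSucc + 2 * g ≤ x i ∧ x i + 2 * g ≤ X i.succ := by
    refine Filter.eventually_all.2 fun i => ?_
    have hc : Tendsto (fun g : ℝ => 2 * g) (nhdsWithin 0 (Set.Ioi 0)) (nhds 0) := by
      have : Tendsto (fun g : ℝ => 2 * g) (nhds 0) (nhds (2 * 0)) :=
        tendsto_id.const_mul 2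
      rw [mul_zero] at this
      exact this.mono_left nhdsWithin_le_nhds
    have h2 := hc.eventually (ge_mem_nhds (sub_pos.2 (h i).1))
    have h3 := hc.eventually (ge_mem_nhds (sub_pos.2 (h i).2))
    filter_upwards [h2, h3] with g hg2 hg3
    constructor <;> linarith
  obtain ⟨g, hg, hg'⟩ := (h1.and self_mem_nhdsWithin).exists
  exact ⟨g, hg', hg⟩

/-- Evaluate the interpolation formula for ∏ (z - x_a) at the unperturbed particle z = `xt i`, where
the unperturbed product vanishes. The perturbed product is then O(D), and all its factors except `xt
i - x i` stay away from zero as long as the upper row moves little. -/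
theorem StrictInterlace.exists_abs_sub_le {m : ℕ} {xt : Fin (m + 1) → ℝ} {Xt : Fin (m + 2) → ℝ}
    (ht : StrictInterlace xt Xt) (hw : ∀ b, rowWeight xt Xt b = 1 / ((m : ℝ) + 2))
    {p q : ℝ} (hXt : ∀ b, Xt b ∈ Set.Icc p q) {K : ℝ} (hK : 0 ≤ K) :
    ∃ K' ≥ 0, ∀ (x : Fin (m + 1) → ℝ) (X : Fin (m + 2) → ℝ) (D : ℝ), 0 ≤ D →
      StrictInterlace x X → (∀ b, X b ∈ Set.Icc p q) → (∀ b, |X b - Xt b| ≤ K * D) →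
      (∀ b, |rowWeight x X b - 1 / ((m : ℝ) + 2)| ≤ D) → ∀ a, |x a - xt a| ≤ K' * D := by
  obtain ⟨g, hg, hgap⟩ := ht.exists_gap
  have hpq : p ≤ q := (hXt 0).1.trans (hXt 0).2
  -- The extra 1 ensures `1 ≤ B`, as the bound for differences of products requires.
  set B : ℝ := q - p + 1 with hBdef
  have hB : 1 ≤ B := by linarith
  have hm : (0 : ℝ) < (m : ℝ) + 2 := by positivity
  set A : ℝ := ((m : ℝ) + 2) * (B ^ (m + 1) + ((m + 1 : ℕ) : ℝ) * B ^ (m + 1) * K) with hA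
  have hA0 : 0 ≤ A := by positivity
  refine ⟨A / g ^ m + B * K / g, by positivity, fun x X D hD hx hX hXX hwx i => ?_⟩
  have hrow : ∀ {u : Fin (m + 1) → ℝ} {U : Fin (m + 2) → ℝ}, StrictInterlace u U →
      (∀ b, U b ∈ Set.Icc p q) → ∀ a, u a ∈ Set.Icc p q := fun {u U} h hU a =>
    ⟨(hU a.castSucc).1.trans (h a).1.le, (h a).2.le.trans (hU a.succ).2⟩
  have hdist : ∀ {u v : ℝ}, u ∈ Set.Icc p q → v ∈ Set.Icc p q → |u - v| ≤ B := by
    intro u v hu hv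
    rw [abs_le]
    constructor <;> linarith [hu.1, hu.2, hv.1, hv.2]
  have hz := hrow ht hXt i
  have hprod : ∏ a, |xt i - x a| ≤ A * D := by
    have h0 : ∑ b : Fin (m + 2), 1 / ((m : ℝ) + 2) * ∏ a, (xt i - Xt (b.succAbove a)) = 0 := by
      have := prod_sub_eq_sum_rowWeight (x := xt) ht.upper_strictMono.injective (xt i)
      rw [Finset.prod_eq_zero (Finset.mem_univ i) (sub_self _)] at this
      simp_rw [hw] at this
      exact this.symm
    rw [← Finset.abs_prod, prod_sub_eq_sum_rowWeight hx.upper_strictMono.injective,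
      ← sub_zero (∑ b, _),
      ← h0, ← Finset.sum_sub_distrib]
    refine (Finset.abs_sum_le_sum_abs _ _).trans ?_
    have hterm : ∀ b, |rowWeight x X b * ∏ a, (xt i - X (b.succAbove a)) -
        1 / ((m : ℝ) + 2) * ∏ a, (xt i - Xt (b.succAbove a))| ≤
        (B ^ (m + 1) + ((m + 1 : ℕ) : ℝ) * B ^ (m + 1) * K) * D := by
      intro b
      have e : rowWeight x X b * ∏ a, (xt i - X (b.succAbove a)) -
          1 / ((m : ℝ) + 2) * ∏ a, (xt i - Xt (b.succAbove a)) =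
          (rowWeight x X b - 1 / ((m : ℝ) + 2)) * ∏ a, (xt i - X (b.succAbove a)) +
          1 / ((m : ℝ) + 2) * (∏ a, (xt i - X (b.succAbove a)) -
            ∏ a, (xt i - Xt (b.succAbove a))) := by ring
      rw [e]
      refine (abs_add_le _ _).trans ?_
      rw [abs_mul, abs_mul, abs_of_pos (one_div_pos.2 hm), add_mul]
      have h1 : |∏ a, (xt i - X (b.succAbove a))| ≤ B ^ (m + 1) := by
        rw [Finset.abs_prod]
        refine (Finset.prod_le_prod (fun _ _ => abs_nonneg _)
          fun a _ => hdist hz (hX (b.succAbove a))).trans ?_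
        simp
      have h2 := abs_prod_sub_prod_le (Finset.univ : Finset (Fin (m + 1))) hB
        (fun a _ => hdist hz (hX (b.succAbove a))) (fun a _ => hdist hz (hXt (b.succAbove a)))
        (δ := K * D) (fun a _ => by
          rw [sub_sub_sub_cancel_left, abs_sub_comm]
          exact hXX _) (by positivity)
      rw [Finset.card_univ, Fintype.card_fin] at h2
      refine add_le_add ?_ ?_
      · rw [mul_comm (B ^ _)]
        exact mul_le_mul (hwx b) h1 (abs_nonneg _) hD
      · refine (mul_le_of_le_one_left (abs_nonneg _) ?_).trans (h2.trans (le_of_eq (by ring)))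
        rw [div_le_one hm]
        linarith [(Nat.cast_nonneg m : (0 : ℝ) ≤ m)]
    refine (Finset.sum_le_sum fun b _ => hterm b).trans (le_of_eq ?_)
    simp [hA]
    ring
  rw [abs_sub_comm]
  rcases le_or_gt (K * D) g with hKD | hKD
  · have hfar : ∀ a, a ≠ i → g ≤ |xt i - x a| := by
      intro a ha
      rcases lt_or_gt_of_ne ha with hai | hai
      · have h1 := hx.lt_of_succ_le (a := a) (b := i.castSucc) (Fin.castSucc_lt_iff_succ_le.1 hai)
        have h2 := (abs_le.1 (hXX i.castSucc)).2
        refine le_trans ?_ (le_abs_self _)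
        linarith [(hgap i).1]
      · have h1 := hx.lt_of_le_castSucc (a := a) (b := i.succ) (Fin.castSucc_lt_iff_succ_le.1 hai)
        have h2 := (abs_le.1 (hXX i.succ)).1
        refine le_trans ?_ (neg_le_abs _)
        linarith [(hgap i).2]
    have h1 : g ^ m * |xt i - x i| ≤ A * D := by
      refine le_trans ?_ hprod
      rw [Fin.prod_univ_succAbove _ i, mul_comm]
      refine mul_le_mul_of_nonneg_left ?_ (abs_nonneg _)
      calc g ^ m = ∏ _a : Fin m, g := by simp
        _ ≤ _ := Finset.prod_le_prod (fun _ _ => hg.le)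
          fun a _ => hfar _ (Fin.succAbove_ne i a)
    have h2 : |xt i - x i| ≤ A / g ^ m * D := by
      rw [div_mul_eq_mul_div, le_div_iff₀ (by positivity), mul_comm]
      exact h1
    rw [add_mul]
    have : 0 ≤ B * K / g * D := by positivity
    linarith
  -- If the upper row may move by more than `g`, then `D` is bounded below and the diameter bound
  -- `B` is already of order `D`.
  · have h1 := hdist hz (hrow hx hX i)
    have h2 : B ≤ B * K / g * D := by
      rw [div_mul_eq_mul_div, le_div_iff₀ hg, mul_assoc]
      exact mul_le_mul_of_nonneg_left hKD.le (by linarith)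
    have : 0 ≤ A / g ^ m * D := by positivity
    rw [add_mul]
    linarith

theorem StrictPattern.mem_Icc {n : ℕ} {x : TriangularArray n} (h : StrictPattern x)
    (hl : StrictMono (x (Fin.last n))) (k : Fin (n + 1)) :
    ∀ i, x k i ∈ Set.Icc (x (Fin.last n) 0) (x (Fin.last n) (Fin.last n)) := by
  induction k using Fin.reverseInduction with
  | last => exact fun i => ⟨hl.monotone (Fin.zero_le i), hl.monotone (Fin.le_last i)⟩
  | cast j ih =>
    exact fun i => ⟨(ih i.castSucc).1.trans (h j i).1.le, (h j i).2.le.trans (ih i.succ).2⟩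

theorem CriticalRows.exists_abs_sub_le {n : ℕ} {y : Fin (n + 1) → ℝ} (hy : StrictMono y)
    {xt : TriangularArray n} (ht : CriticalRows y xt) (k : Fin (n + 1)) :
    ∃ K ≥ 0, ∀ x : TriangularArray n, StrictPattern x → x (Fin.last n) = y →
      ∀ i, |x k i - xt k i| ≤ K * weightDeviation x := by
  induction k using Fin.reverseInduction with
  | last => exact ⟨0, le_rfl, fun x _ hl i => by simp [hl, ht.last]⟩
  | cast j ih =>
    obtain ⟨K, hK, hx⟩ := ih
    have hmem : ∀ x : TriangularArray n, StrictPattern x → x (Fin.last n) = y → ∀ k i,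
        x k i ∈ Set.Icc (y 0) (y (Fin.last n)) := fun x h hl k i => by
      have := h.mem_Icc (hl.symm ▸ hy) k i
      rwa [hl] at this
    obtain ⟨K', hK', h'⟩ := (ht.strict j).exists_abs_sub_le
      (rowWeight_eq_of_derivative (ht.strict j).upper_strictMono.injective (ht.derivative j))
      (hmem xt ht.strict ht.last j.succ) hK
    exact ⟨K', hK', fun x hs hl => h' _ _ _ (Real.sqrt_nonneg _) (hs j) (hmem x hs hl j.succ)
      (hx x hs hl) (abs_rowWeight_sub_le x j)⟩

/-- This one global quadratic bound supplies both the maximality of `xt` and the Gaussian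
domination. -/
theorem CriticalRows.exists_logPotential_sub_le {n : ℕ} {y : Fin (n + 1) → ℝ}
    (hy : StrictMono y) {xt : TriangularArray n} (ht : CriticalRows y xt) :
    ∃ c > 0, ∀ x : TriangularArray n, StrictPattern x → x (Fin.last n) = y →
      logPotential x - logPotential xt ≤
        -(c * ∑ k : Fin n, ∑ i : Fin (k + 1), (x k.castSucc i - xt k.castSucc i) ^ 2) := by
  choose K hK hx using ht.exists_abs_sub_le hy
  set M : ℝ := ∑ k : Fin n, ∑ _i : Fin (k + 1), K k.castSucc ^ 2 with hM
  have hM0 : 0 ≤ M := Finset.sum_nonneg fun _ _ => Finset.sum_nonneg fun _ _ => sq_nonneg _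
  -- `M` can be zero, hence the division by `M + 1`.
  refine ⟨1 / (2 * ((n : ℝ) + 3)) / (M + 1), by positivity, fun x hs hl => ?_⟩
  refine (ht.logPotential_sub_le hs hl).trans ?_
  have h1 : ∑ k : Fin n, ∑ i : Fin (k + 1), (x k.castSucc i - xt k.castSucc i) ^ 2 ≤
      (M + 1) * weightDeviation x ^ 2 := by
    refine le_trans ?_ (mul_le_mul_of_nonneg_right (by linarith : M ≤ M + 1) (sq_nonneg _))
    rw [hM, Finset.sum_mul]
    refine Finset.sum_le_sum fun k _ => ?_
    rw [Finset.sum_mul]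
    refine Finset.sum_le_sum fun i _ => ?_
    rw [← mul_pow, ← sq_abs (x k.castSucc i - _)]
    exact pow_le_pow_left₀ (abs_nonneg _) (hx k.castSucc x hs hl i) 2
  rw [neg_mul, neg_le_neg_iff, div_mul_eq_mul_div, div_le_iff₀ (by positivity), mul_assoc,
    mul_comm (_ ^ 2)]
  exact mul_le_mul_of_nonneg_left h1 (by positivity)

/-! ### A one-row bound of Dixon-Anderson type -/

/-- The product of the `s`-th powers of the gaps of a row. -/
noncomputable def gapPow {m : ℕ} (s : ℝ) (x : Fin m → ℝ) : ℝ :=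
  ∏ i, ∏ j ∈ Finset.Ioi i, (x j - x i) ^ s

/-- The product of the `s`-th powers of the distances between two adjacent rows. -/
noncomputable def crossPow {m : ℕ} (s : ℝ) (x : Fin (m + 1) → ℝ) (X : Fin (m + 2) → ℝ) : ℝ :=
  ∏ a, ∏ b, |x a - X b| ^ s

theorem gapPow_pos {m : ℕ} {x : Fin m → ℝ} (hx : StrictMono x) (s : ℝ) : 0 < gapPow s x :=
  Finset.prod_pos fun _ _ => Finset.prod_pos fun _ hj =>
    Real.rpow_pos_of_pos (sub_pos.2 (hx (Finset.mem_Ioi.1 hj))) s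

theorem gapPow_add {m : ℕ} {x : Fin m → ℝ} (hx : StrictMono x) (s t : ℝ) :
    gapPow (s + t) x = gapPow s x * gapPow t x := by
  simp_rw [gapPow, ← Finset.prod_mul_distrib]
  refine Finset.prod_congr rfl fun i _ => Finset.prod_congr rfl fun j hj => ?_
  exact Real.rpow_add (sub_pos.2 (hx (Finset.mem_Ioi.1 hj))) s t

theorem gapPow_succ {m : ℕ} (s : ℝ) (X : Fin (m + 2) → ℝ) :
    gapPow s X = (∏ a : Fin (m + 1), (X a.succ - X a.castSucc) ^ s) *
      ∏ a : Fin (m + 1), ∏ c ∈ Finset.Ioi a, (X c.succ - X a.castSucc) ^ s := by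
  rw [gapPow, Fin.prod_univ_castSucc, ← Finset.prod_mul_distrib]
  have hlast : (Finset.Ioi (Fin.last (m + 1))) = ∅ := by
    ext j
    simpa using Fin.le_last j
  rw [hlast, Finset.prod_empty, mul_one]
  refine Finset.prod_congr rfl fun a _ => ?_
  have h : Finset.Ioi a.castSucc = (Finset.Ici a).image Fin.succ := by
    ext j
    induction j using Fin.cases with
    | zero => simp
    | succ j =>
      simp only [Finset.mem_Ioi, Finset.mem_image, Finset.mem_Ici, Fin.succ_inj, exists_eq_right]
      exact Fin.castSucc_lt_succ_iff
  rw [h, Finset.prod_image (s := Finset.Ici a) (g := Fin.succ)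
    (fun i _ j _ hij => Fin.succ_injective _ hij), ← Finset.Ioi_insert,
    Finset.prod_insert (by simp)]

/-- The pairing matches `gapPow_succ`: near factors belong to the gap of the upper row containing
particle `a`, and for `a < c` the two far factors belong to the span from `X a.castSucc` to `X
c.succ`. -/
theorem prod_prod_eq_near_mul_far {M : Type*} [CommMonoid M] {m : ℕ}
    (f : Fin (m + 1) → Fin (m + 2) → M) :
    ∏ a, ∏ b, f a b = (∏ a, f a a.castSucc * f a a.succ) *
      ∏ a, ∏ c ∈ Finset.Ioi a, f a c.succ * f c a.castSucc := by
  have h1 : ∀ a, ∏ b, f a b = (f a a.castSucc * f a a.succ) *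
      ∏ c ∈ ({a}ᶜ : Finset (Fin (m + 1))), f a (a.castSucc.succAbove c) := by
    intro a
    rw [Fin.prod_univ_succAbove _ a.castSucc, ← Finset.prod_mul_prod_compl {a},
      Finset.prod_singleton, mul_assoc]
    simp
  simp_rw [h1, Finset.prod_mul_distrib]
  congr 1
  rw [← Finset.prod_prod_Ioi_mul_eq_prod_prod_off_diag
    (fun c a => f a (a.castSucc.succAbove c))]
  simp_rw [← Finset.prod_mul_distrib]
  refine Finset.prod_congr rfl fun a _ => Finset.prod_congr rfl fun c hc => ?_
  have hac := Finset.mem_Ioi.1 hc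
  rw [Fin.succAbove_of_le_castSucc _ _ (by simpa using hac.le),
    Fin.succAbove_of_castSucc_lt _ _ (by simpa using hac)]

/-- The two summands of the constant cover the two signs of `t - 1`. -/
theorem rpow_sub_one_max_le {t L v : ℝ} (hL : 0 < L) (hv : L / 2 ≤ v) (hv' : v ≤ L) :
    v ^ (t - 1) ≤ (1 + (1 / 2 : ℝ) ^ (t - 1)) * L ^ (t - 1) := by
  have h0 : 0 < L ^ (t - 1) := Real.rpow_pos_of_pos hL _
  have h1 : 0 < (1 / 2 : ℝ) ^ (t - 1) := Real.rpow_pos_of_pos (by norm_num) _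
  rcases le_total 1 t with ht | ht
  · have := Real.rpow_le_rpow (by linarith) hv' (sub_nonneg.2 ht)
    nlinarith
  · have := Real.rpow_le_rpow_of_nonpos (by linarith : 0 < L / 2) hv (sub_nonpos.2 ht)
    rw [div_eq_mul_one_div, Real.mul_rpow hL.le (by norm_num)] at this
    nlinarith

/-- The larger of u and v is at least L / 2, so its power is comparable to that of L; the possible
singularity of the smaller one is absorbed by the factor s, which is no larger than it. -/
theorem mul_rpow_mul_rpow_le {t s u v L : ℝ} (ht : 0 < t) (hs : 0 < s) (hsu : s ≤ u)
    (hsv : s ≤ v) (h : u + v = L + s) (huL : u ≤ L) (hvL : v ≤ L) :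
    s * (u ^ (t - 1) * v ^ (t - 1)) ≤ (1 + (1 / 2 : ℝ) ^ (t - 1)) * L ^ (2 * t - 1) := by
  wlog huv : u ≤ v generalizing u v
  · rw [mul_comm (u ^ _)]
    exact this hsv hsu (by linarith) hvL huL (by linarith)
  have hL : 0 < L := by linarith
  have h1 := rpow_sub_one_max_le (t := t) hL (v := v) (by linarith) hvL
  have h2 : s * u ^ (t - 1) ≤ L ^ t := by
    have hu : 0 < u := by linarith
    calc s * u ^ (t - 1) ≤ u * u ^ (t - 1) :=
          mul_le_mul_of_nonneg_right hsu (Real.rpow_nonneg hu.le _)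
      _ = u ^ t := by rw [← Real.rpow_one_add' hu.le (by simpa using ht.ne')]; congr 1; ring
      _ ≤ L ^ t := Real.rpow_le_rpow hu.le huL ht.le
  rw [← mul_assoc]
  refine (mul_le_mul h2 h1 (Real.rpow_nonneg (by linarith) _) (Real.rpow_nonneg hL.le _)).trans
    (le_of_eq ?_)
  rw [mul_left_comm, ← Real.rpow_add hL]
  congr 2
  ring

theorem rpow_mul_rpow_le_add {t u v L : ℝ} (hu : 0 < u) (hv : 0 < v) (h : u + v = L) :
    u ^ (t - 1) * v ^ (t - 1) ≤
      (1 + (1 / 2 : ℝ) ^ (t - 1)) * L ^ (t - 1) * (u ^ (t - 1) + v ^ (t - 1)) := by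
  wlog huv : u ≤ v generalizing u v
  · rw [mul_comm (u ^ _), add_comm (u ^ _)]
    exact this hv hu (by linarith) (by linarith)
  have hL : 0 < L := by linarith
  have h1 := rpow_sub_one_max_le (t := t) hL (v := v) (by linarith) (by linarith)
  have hu' := Real.rpow_pos_of_pos hu (t - 1)
  have hv' := Real.rpow_pos_of_pos hv (t - 1)
  nlinarith

/-- A function on an interval that dominates the Beta density. -/
noncomputable def betaBound (t p q z : ℝ) : ℝ :=
  (Set.Ioc p q).indicator (fun z => (1 + (1 / 2 : ℝ) ^ (t - 1)) * (q - p) ^ (t - 1) *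
    ((z - p) ^ (t - 1) + (q - z) ^ (t - 1))) z

theorem betaBound_nonneg (t p q z : ℝ) : 0 ≤ betaBound t p q z := by
  refine Set.indicator_nonneg (fun z hz => ?_) z
  have h1 : 0 ≤ z - p := sub_nonneg.2 hz.1.le
  have h2 : 0 ≤ q - z := sub_nonneg.2 hz.2
  have h3 : 0 ≤ q - p := by linarith
  positivity

theorem integrable_betaBound_and_integral {t p q : ℝ} (ht : 0 < t) (hpq : p < q) :
    Integrable (betaBound t p q) volume ∧
      ∫ z, betaBound t p q z = (2 * (1 + (1 / 2 : ℝ) ^ (t - 1)) / t) * (q - p) ^ (2 * t - 1) := by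
  have ht' : -1 < t - 1 := by linarith
  have h1 : IntervalIntegrable (fun z => (z - p) ^ (t - 1)) volume p q := by
    have := (intervalIntegral.intervalIntegrable_rpow' ht' (a := 0) (b := q - p)).comp_sub_right p
    simpa using this
  have h2 : IntervalIntegrable (fun z => (q - z) ^ (t - 1)) volume p q := by
    have := (intervalIntegral.intervalIntegrable_rpow' ht' (a := q - p) (b := 0)).comp_sub_left q
    simpa using this
  have h3 := (h1.add h2).const_mul ((1 + (1 / 2 : ℝ) ^ (t - 1)) * (q - p) ^ (t - 1))
  constructor
  · unfold betaBound
    rw [integrable_indicator_iff measurableSet_Ioc]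
    exact (intervalIntegrable_iff_integrableOn_Ioc_of_le hpq.le).1 h3
  · unfold betaBound
    rw [integral_indicator measurableSet_Ioc, ← intervalIntegral.integral_of_le hpq.le,
      intervalIntegral.integral_const_mul, intervalIntegral.integral_add h1 h2,
      intervalIntegral.integral_comp_sub_right (fun z => z ^ (t - 1)) p,
      intervalIntegral.integral_comp_sub_left (fun z => z ^ (t - 1)) q, sub_self, sub_self,
      integral_rpow (Or.inl ht')]
    have hL : 0 < q - p := sub_pos.2 hpq
    rw [sub_add_cancel, Real.zero_rpow ht.ne', show 2 * t - 1 = (t - 1) + t by ring,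
      Real.rpow_add hL]
    ring

/-- Each Vandermonde factor `x c - x a` is spent on the two far factors of its pair, bounding them
by the upper row alone. What remains is one Beta-type density per gap, so the bound factorizes over
the particles. -/
theorem StrictInterlace.gapPow_mul_crossPow_le {m : ℕ} {x : Fin (m + 1) → ℝ}
    {X : Fin (m + 2) → ℝ} (h : StrictInterlace x X) {t : ℝ} (ht : 0 < t) :
    gapPow 1 x * crossPow (t - 1) x X ≤
      (∏ a, betaBound t (X a.castSucc) (X a.succ) (x a)) *
        ∏ a : Fin (m + 1), ∏ c ∈ Finset.Ioi a,
          ((1 + (1 / 2 : ℝ) ^ (t - 1)) * (X c.succ - X a.castSucc) ^ (2 * t - 1)) := by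
  have e : gapPow 1 x * crossPow (t - 1) x X =
      (∏ a, |x a - X a.castSucc| ^ (t - 1) * |x a - X a.succ| ^ (t - 1)) *
      ∏ a : Fin (m + 1), ∏ c ∈ Finset.Ioi a,
        ((x c - x a) * (|x a - X c.succ| ^ (t - 1) * |x c - X a.castSucc| ^ (t - 1))) := by
    rw [crossPow, prod_prod_eq_near_mul_far, gapPow, mul_left_comm]
    simp_rw [Real.rpow_one, ← Finset.prod_mul_distrib]
  rw [e]
  refine mul_le_mul ?_ ?_ ?_ ?_
  · refine Finset.prod_le_prod (fun _ _ => by positivity) fun a _ => ?_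
    have h1 := (h a).1
    have h2 := (h a).2
    rw [betaBound, Set.indicator_of_mem (show x a ∈ Set.Ioc (X a.castSucc) (X a.succ) from
      ⟨h1, h2.le⟩), abs_of_pos (sub_pos.2 h1), abs_sub_comm,
      abs_of_pos (sub_pos.2 h2)]
    exact rpow_mul_rpow_le_add (sub_pos.2 h1) (sub_pos.2 h2) (by ring)
  · have hnn : ∀ a c, c ∈ Finset.Ioi a → 0 ≤ (x c - x a) *
        (|x a - X c.succ| ^ (t - 1) * |x c - X a.castSucc| ^ (t - 1)) := fun a c hc =>
      mul_nonneg (sub_nonneg.2 (h.lower_strictMono (Finset.mem_Ioi.1 hc)).le) (by positivity)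
    refine Finset.prod_le_prod (fun a _ => Finset.prod_nonneg (hnn a)) fun a _ =>
      Finset.prod_le_prod (hnn a) fun c hc => ?_
    have hac := h.lower_strictMono (Finset.mem_Ioi.1 hc)
    have h1 := (h a).1
    have h2 := (h c).2
    rw [abs_sub_comm (x a), abs_of_pos (by linarith : 0 < X c.succ - x a),
      abs_of_pos (by linarith : 0 < x c - X a.castSucc)]
    exact mul_rpow_mul_rpow_le ht (by linarith) (by linarith) (by linarith) (by ring)
      (by linarith) (by linarith)
  · exact Finset.prod_nonneg fun a _ => Finset.prod_nonneg fun c hc =>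
      mul_nonneg (sub_nonneg.2 (h.lower_strictMono (Finset.mem_Ioi.1 hc)).le) (by positivity)
  · exact Finset.prod_nonneg fun a _ => betaBound_nonneg _ _ _ _

theorem exists_lintegral_interlace_le (m : ℕ) {t : ℝ} (ht : 0 < t) :
    ∃ K ≥ 0, ∀ X : Fin (m + 2) → ℝ, StrictMono X →
      ∫⁻ x : Fin (m + 1) → ℝ, {x | StrictInterlace x X}.indicator
        (fun x => ENNReal.ofReal (gapPow 1 x * crossPow (t - 1) x X)) x ≤
        ENNReal.ofReal (K * gapPow (2 * t - 1) X) := by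
  set A : ℝ := 1 + (1 / 2 : ℝ) ^ (t - 1) with hA
  have hA0 : 0 < A := by positivity
  refine ⟨(∏ _a : Fin (m + 1), (2 * A / t)) *
    ∏ a : Fin (m + 1), ∏ _c ∈ Finset.Ioi a, A, by positivity, fun X hX => ?_⟩
  set G : ℝ := ∏ a : Fin (m + 1), ∏ c ∈ Finset.Ioi a,
    (A * (X c.succ - X a.castSucc) ^ (2 * t - 1)) with hG
  have hG0 : 0 ≤ G := Finset.prod_nonneg fun a _ => Finset.prod_nonneg fun c hc => by
    have : X a.castSucc < X c.succ := hX (by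
      have := Finset.mem_Ioi.1 hc
      simp only [Fin.lt_def, Fin.val_castSucc, Fin.val_succ] at this ⊢
      omega)
    have := sub_pos.2 this
    positivity
  have hb := fun a : Fin (m + 1) =>
    integrable_betaBound_and_integral ht (hX (Fin.castSucc_lt_succ (i := a)))
  have hint : Integrable (fun x : Fin (m + 1) → ℝ =>
      ∏ a, betaBound t (X a.castSucc) (X a.succ) (x a)) volume :=
    Integrable.fintype_prod fun a => (hb a).1
  calc _ ≤ ∫⁻ x : Fin (m + 1) → ℝ, ENNReal.ofReal
        ((∏ a, betaBound t (X a.castSucc) (X a.succ) (x a)) * G) := by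
        refine lintegral_mono fun x => ?_
        by_cases hx : StrictInterlace x X
        · rw [Set.indicator_of_mem (by exact hx)]
          exact ENNReal.ofReal_le_ofReal (hx.gapPow_mul_crossPow_le ht)
        · rw [Set.indicator_of_notMem (by exact hx)]
          exact zero_le
    _ = ENNReal.ofReal (∫ x : Fin (m + 1) → ℝ,
        (∏ a, betaBound t (X a.castSucc) (X a.succ) (x a)) * G) := by
        rw [ofReal_integral_eq_lintegral_ofReal (hint.mul_const G)]
        exact Eventually.of_forall fun x =>
          mul_nonneg (Finset.prod_nonneg fun a _ => betaBound_nonneg _ _ _ _) hG0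
    _ = _ := by
        rw [integral_mul_const]
        have hprod : ∫ x : Fin (m + 1) → ℝ, ∏ a, betaBound t (X a.castSucc) (X a.succ) (x a) =
            ∏ a : Fin (m + 1), ∫ z, betaBound t (X a.castSucc) (X a.succ) z :=
          integral_fintype_prod_volume_eq_prod (E := fun _ : Fin (m + 1) => ℝ)
            (fun a : Fin (m + 1) => betaBound t (X a.castSucc) (X a.succ))
        rw [hprod]
        congr 1
        simp_rw [fun a => (hb a).2]
        rw [gapPow_succ, hG]
        simp_rw [Finset.prod_mul_distrib]
        ring

/-! ### Total mass of the corners measure -/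

theorem measurePreserving_withTopRow (n : ℕ) :
    MeasurePreserving (fun p : (Fin (n + 1) → ℝ) × LowerRows n =>
      (withTopRow p.1 p.2 : LowerRows (n + 1))) (volume.prod volume) volume := by
  have hmeas : Measurable (fun p : (Fin (n + 1) → ℝ) × LowerRows n =>
      (withTopRow p.1 p.2 : LowerRows (n + 1))) := by
    refine measurable_pi_lambda _ fun k => ?_
    induction k using Fin.lastCases with
    | last =>
      simp only [withTopRow_last]
      exact measurable_fst
    | cast j =>
      simp only [withTopRow_castSucc]
      exact (measurable_pi_apply j).comp measurable_snd
  refine ⟨hmeas, ?_⟩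
  refine Measure.pi_eq (μ := fun k : Fin (n + 1) => (volume : Measure (Fin (k + 1) → ℝ)))
    (fun s hs => ?_) |>.symm
  rw [Measure.map_apply hmeas (MeasurableSet.univ_pi hs)]
  have hpre : (fun p : (Fin (n + 1) → ℝ) × LowerRows n =>
      (withTopRow p.1 p.2 : LowerRows (n + 1))) ⁻¹' Set.univ.pi s =
      s (Fin.last n) ×ˢ Set.univ.pi fun k : Fin n => s k.castSucc := by
    ext p
    simp only [Set.mem_preimage, Set.mem_univ_pi, Set.mem_prod]
    constructor
    · intro h
      refine ⟨by simpa only [withTopRow_last] using h (Fin.last n), fun k => ?_⟩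
      simpa only [withTopRow_castSucc] using h k.castSucc
    · rintro ⟨h1, h2⟩ k
      induction k using Fin.lastCases with
      | last => simpa only [withTopRow_last] using h1
      | cast j => simpa only [withTopRow_castSucc] using h2 j
  rw [hpre, Measure.prod_prod, Fin.prod_univ_castSucc, mul_comm, volume_pi, Measure.pi_pi]

theorem cornersWeight_eq {n : ℕ} (β : ℝ) (x : TriangularArray n) :
    cornersWeight β x = ∏ k : Fin n, gapPow (2 - β) (x k.castSucc) *
      crossPow (m := k) (β / 2 - 1) (x k.castSucc) (x k.succ) := rfl

theorem measurable_withTopRow {n : ℕ} (y : Fin (n + 1) → ℝ) :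
    Measurable (withTopRow y : LowerRows n → TriangularArray n) :=
  (measurePreserving_withTopRow n).measurable.comp measurable_prodMk_left

theorem measurable_cornersWeight {n : ℕ} (β : ℝ) :
    Measurable (cornersWeight β : TriangularArray n → ℝ) := by
  unfold cornersWeight
  fun_prop

theorem isOpen_strictPattern (n : ℕ) : IsOpen {x : TriangularArray n | StrictPattern x} := by
  simp only [StrictPattern, StrictInterlace, Set.ofPred_forall, Set.ofPred_and]
  refine isOpen_iInter_of_finite fun k => isOpen_iInter_of_finite fun i => ?_
  exact (isOpen_lt (by fun_prop) (by fun_prop)).inter (isOpen_lt (by fun_prop) (by fun_prop))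

theorem strictPattern_withTopRow_withTopRow {n : ℕ} (y : Fin (n + 2) → ℝ) (r : Fin (n + 1) → ℝ)
    (x : LowerRows n) : StrictPattern (withTopRow y (withTopRow r x : LowerRows (n + 1))) ↔
      StrictInterlace r y ∧ StrictPattern (withTopRow r x) := by
  have hcast := withTopRow_castSucc y (withTopRow r x : LowerRows (n + 1))
  have hsucc : ∀ j : Fin n, withTopRow y (withTopRow r x : LowerRows (n + 1)) j.castSucc.succ =
      withTopRow r x j.succ := fun j => hcast j.succ
  have hlast : withTopRow y (withTopRow r x : LowerRows (n + 1)) (Fin.last n).succ = y :=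
    withTopRow_last _ _
  rw [StrictPattern, Fin.forall_fin_succ']
  simp only [hcast, hsucc, hlast, withTopRow_last]
  exact and_comm

theorem cornersWeight_withTopRow_withTopRow {n : ℕ} (β : ℝ) (y : Fin (n + 2) → ℝ)
    (r : Fin (n + 1) → ℝ) (x : LowerRows n) :
    cornersWeight β (withTopRow y (withTopRow r x : LowerRows (n + 1))) =
      gapPow (2 - β) r * crossPow (β / 2 - 1) r y * cornersWeight β (withTopRow r x) := by
  have hcast := withTopRow_castSucc y (withTopRow r x : LowerRows (n + 1))
  have hsucc : ∀ j : Fin n, withTopRow y (withTopRow r x : LowerRows (n + 1)) j.castSucc.succ =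
      withTopRow r x j.succ := fun j => hcast j.succ
  have hlast : withTopRow y (withTopRow r x : LowerRows (n + 1)) (Fin.last n).succ = y :=
    withTopRow_last _ _
  rw [cornersWeight_eq, cornersWeight_eq, Fin.prod_univ_castSucc, mul_comm]
  simp only [hcast, hsucc, hlast, withTopRow_last]

/-- The weight of the `β`-corners process, restricted to strictly interlacing arrays. -/
noncomputable def strictDensity {n : ℕ} (β : ℝ) (y : Fin (n + 1) → ℝ) (x : LowerRows n) :
    ENNReal :=
  {x | StrictPattern (withTopRow y x)}.indicator
    (fun x => ENNReal.ofReal (cornersWeight β (withTopRow y x))) x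

theorem measurable_strictDensity {n : ℕ} (β : ℝ) (y : Fin (n + 1) → ℝ) :
    Measurable (strictDensity β y) :=
  Measurable.indicator
    ((measurable_cornersWeight β).comp (measurable_withTopRow y)).ennreal_ofReal
    ((isOpen_strictPattern n).measurableSet.preimage (measurable_withTopRow y))

/-- The power β - 1 reproduces itself: times the weight `gapPow (2 - β)` of the next row it becomes
the first power of the Vandermonde, and the one-row bound with t = β/2 returns the power 2t - 1 = β
- 1. -/
theorem exists_lintegral_strictDensity_le (n : ℕ) {β : ℝ} (hβ : 0 < β) :
    ∃ K ≥ 0, ∀ y : Fin (n + 1) → ℝ, StrictMono y →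
      ∫⁻ x, strictDensity β y x ≤ ENNReal.ofReal (K * gapPow (β - 1) y) := by
  induction n with
  | zero =>
    refine ⟨1, zero_le_one, fun y _ => ?_⟩
    have h1 : gapPow (β - 1) y = 1 := by
      refine Finset.prod_eq_one fun i _ => Finset.prod_eq_one fun j hj => ?_
      have := Finset.mem_Ioi.1 hj
      omega
    have h2 : ∀ x, strictDensity β y x ≤ 1 := fun x =>
      (Set.indicator_le_self _ _ x).trans (by simp [cornersWeight])
    refine (lintegral_mono h2).trans ?_
    rw [h1, lintegral_one, volume_pi, Measure.pi_of_empty]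
    simp
  | succ n ih =>
    obtain ⟨K, hK, hK'⟩ := ih
    obtain ⟨A, hA, hA'⟩ := exists_lintegral_interlace_le n (t := β / 2) (by linarith)
    refine ⟨K * A, by positivity, fun y hy => ?_⟩
    rw [← (measurePreserving_withTopRow n).lintegral_comp (measurable_strictDensity β y)]
    refine (lintegral_prod_le _).trans ?_
    have hstep : ∀ r : Fin (n + 1) → ℝ,
        ∫⁻ x : LowerRows n, strictDensity β y (withTopRow r x) ≤
        ENNReal.ofReal K * {r | StrictInterlace r y}.indicator
          (fun r => ENNReal.ofReal (gapPow 1 r * crossPow (β / 2 - 1) r y)) r := by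
      intro r
      by_cases hr : StrictInterlace r y
      · have hmono := hr.lower_strictMono
        have hc : 0 ≤ crossPow (β / 2 - 1) r y :=
          Finset.prod_nonneg fun _ _ => Finset.prod_nonneg fun _ _ => by positivity
        rw [Set.indicator_of_mem (by exact hr)]
        have e : ∀ x : LowerRows n, strictDensity β y (withTopRow r x) =
            ENNReal.ofReal (gapPow (2 - β) r * crossPow (β / 2 - 1) r y) *
              strictDensity β r x := by
          intro x
          by_cases hx : StrictPattern (withTopRow r x)
          · rw [strictDensity, strictDensity, Set.indicator_of_mem (by
              exact (strictPattern_withTopRow_withTopRow y r x).2 ⟨hr, hx⟩),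
              Set.indicator_of_mem (by exact hx), cornersWeight_withTopRow_withTopRow,
              ENNReal.ofReal_mul (mul_nonneg (gapPow_pos hmono _).le hc)]
          · rw [strictDensity, strictDensity, Set.indicator_of_notMem (by
              exact fun h => hx ((strictPattern_withTopRow_withTopRow y r x).1 h).2),
              Set.indicator_of_notMem (by exact hx), mul_zero]
        simp_rw [e]
        rw [lintegral_const_mul _ (measurable_strictDensity β r)]
        refine (mul_le_mul_right (hK' r hmono) _).trans (le_of_eq ?_)
        rw [← ENNReal.ofReal_mul (mul_nonneg (gapPow_pos hmono _).le hc),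
          ← ENNReal.ofReal_mul hK]
        congr 1
        have := gapPow_add hmono (2 - β) (β - 1)
        rw [show (2 - β) + (β - 1) = 1 by ring] at this
        rw [this]
        ring
      · have e : ∀ x : LowerRows n, strictDensity β y (withTopRow r x) = 0 := fun x =>
          Set.indicator_of_notMem (by
            exact fun h => hr ((strictPattern_withTopRow_withTopRow y r x).1 h).1) _
        simp [e]
    refine (lintegral_mono hstep).trans ?_
    rw [lintegral_const_mul' _ _ ENNReal.ofReal_ne_top, mul_assoc K, ENNReal.ofReal_mul hK]
    refine mul_le_mul_right ((hA' y hy).trans (le_of_eq ?_)) _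
    rw [mul_div_cancel₀ _ (two_ne_zero' ℝ)]

/-- The level set is a proper affine subspace. -/
theorem volume_linearMap_eq_const {E : Type*} [NormedAddCommGroup E] [NormedSpace ℝ E]
    [MeasurableSpace E] [BorelSpace E] [FiniteDimensional ℝ E] (μ : Measure E)
    [μ.IsAddHaarMeasure] (f : E →ₗ[ℝ] ℝ) {v : E} (hv : f v ≠ 0) (c : ℝ) :
    μ {x | f x = c} = 0 := by
  have h := Measure.addHaar_affineSubspace μ
    ((AffineSubspace.mk' c (⊥ : Submodule ℝ ℝ)).comap f.toAffineMap) ?_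
  · convert h
    ext x
    simp [sub_eq_zero]
  · intro htop
    have hmem : ∀ x, f x = c := fun x => by
      have hx : x ∈ ((AffineSubspace.mk' c (⊥ : Submodule ℝ ℝ)).comap f.toAffineMap) := by
        rw [htop]
        exact AffineSubspace.mem_top ℝ E x
      simpa [sub_eq_zero] using hx
    exact hv (by rw [hmem v, ← hmem 0, map_zero])

theorem ae_ne_succ_row {n : ℕ} (y : Fin (n + 1) → ℝ) (k : Fin n) (i : Fin (k + 1))
    (j : Fin (k + 2)) : ∀ᵐ x : LowerRows n, x k i ≠ withTopRow y x k.succ j := by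
  obtain ⟨f, v, c, hv, hf⟩ : ∃ (f : LowerRows n →ₗ[ℝ] ℝ) (v : LowerRows n) (c : ℝ), f v ≠ 0 ∧
      ∀ x, x k i = withTopRow y x k.succ j → f x = c := by
    let coord : (l : Fin n) → Fin (l + 1) → LowerRows n →ₗ[ℝ] ℝ := fun l i =>
      { toFun := fun x => x l i, map_add' := fun _ _ => rfl, map_smul' := fun _ _ => rfl }
    have hcoord : ∀ l i x, coord l i x = x l i := fun _ _ _ => rfl
    -- The row above is either another free row, giving a difference of two distinct coordinates, or
    -- the fixed top row, giving a single coordinate and a constant.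
    rcases Fin.eq_castSucc_or_eq_last k.succ with ⟨l, hl⟩ | hl
    · have hlk : l ≠ k := by
        rintro rfl
        exact (Fin.castSucc_lt_succ (i := l)).ne hl.symm
      have hval : (k : ℕ) + 2 = l + 1 := congrArg (fun a : Fin (n + 1) => (a : ℕ) + 1) hl
      have hj : ∀ (l' : Fin (n + 1)) (h : l' = l.castSucc) (j : Fin (l' + 1)) (x : LowerRows n),
          withTopRow y x l' j = x l (j.cast (congrArg (fun a : Fin (n + 1) => (a : ℕ) + 1) h)) := by
        rintro _ rfl j x
        rw [withTopRow_castSucc]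
        rfl
      refine ⟨coord k i - coord l (j.cast hval), Pi.single k (Pi.single i 1), 0, ?_,
        fun x hx => ?_⟩
      · simp [hcoord, hlk]
      · rw [LinearMap.sub_apply, sub_eq_zero]
        exact hx.trans (hj _ hl j x)
    · refine ⟨coord k i, Pi.single k (Pi.single i 1), withTopRow y 0 k.succ j,
        by simp [hcoord], fun x hx => ?_⟩
      have hj : ∀ (l : Fin (n + 1)) (j : Fin (l + 1)) (x x' : LowerRows n), l = Fin.last n →
          withTopRow y x l j = withTopRow y x' l j := by
        rintro l j x x' rfl
        rw [withTopRow_last, withTopRow_last]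
      rw [hcoord, hx, hj _ j x 0 hl]
  exact measure_mono_null (fun x hx => hf x (not_not.1 hx))
    (volume_linearMap_eq_const volume f hv c)

/-- Patterns with equality in some interlacing condition lie in finitely many hyperplanes, so strict
interlacing may be assumed throughout. -/
theorem ae_strictDensity_eq {n : ℕ} (β : ℝ) (y : Fin (n + 1) → ℝ) :
    ({x | IsGelfandTsetlin (withTopRow y x)}.indicator
      fun x => ENNReal.ofReal (cornersWeight β (withTopRow y x))) =ᵐ[volume]
      strictDensity β y := by
  have h : ∀ᵐ x : LowerRows n, ∀ (k : Fin n) (i : Fin (k + 1)),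
      x k i ≠ withTopRow y x k.succ i.castSucc ∧ x k i ≠ withTopRow y x k.succ i.succ :=
    ae_all_iff.2 fun k => ae_all_iff.2 fun i =>
      (ae_ne_succ_row y k i _).and (ae_ne_succ_row y k i _)
  filter_upwards [h] with x hx
  have hiff : IsGelfandTsetlin (withTopRow y x) ↔ StrictPattern (withTopRow y x) := by
    constructor
    · intro hg k i
      have h1 := hx k i
      have h2 := hg k i
      rw [withTopRow_castSucc] at h2 ⊢
      exact ⟨lt_of_le_of_ne h2.1 h1.1.symm, lt_of_le_of_ne h2.2 h1.2⟩
    · exact fun hs k i => ⟨(hs k i).1.le, (hs k i).2.le⟩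
  rw [strictDensity]
  by_cases hs : StrictPattern (withTopRow y x)
  · rw [Set.indicator_of_mem (by exact hiff.2 hs), Set.indicator_of_mem (by exact hs)]
  · rw [Set.indicator_of_notMem (by exact fun h => hs (hiff.1 h)),
      Set.indicator_of_notMem (by exact hs)]

theorem cornersLowerMeasure_eq {n : ℕ} (β : ℝ) (y : Fin (n + 1) → ℝ) :
    cornersLowerMeasure β y = volume.withDensity (strictDensity β y) :=
  withDensity_congr_ae (ae_strictDensity_eq β y)

theorem StrictPattern.cornersWeight_pos {n : ℕ} {x : TriangularArray n} (h : StrictPattern x)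
    (β : ℝ) : 0 < cornersWeight β x := by
  rw [cornersWeight_eq]
  refine Finset.prod_pos fun k _ => mul_pos (gapPow_pos (h k).lower_strictMono _) ?_
  exact Finset.prod_pos fun a _ => Finset.prod_pos fun b _ =>
    Real.rpow_pos_of_pos (abs_pos.2 (sub_ne_zero.2 ((h k).ne a b))) _

theorem continuous_withTopRow {n : ℕ} (y : Fin (n + 1) → ℝ) :
    Continuous (withTopRow y : LowerRows n → TriangularArray n) := by
  refine continuous_pi fun k => ?_
  induction k using Fin.lastCases with
  | last => simpa only [withTopRow_last] using continuous_const
  | cast j => simpa only [withTopRow_castSucc] using continuous_apply j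

theorem withTopRow_eta {n : ℕ} (x : TriangularArray n) :
    withTopRow (n := n) (x (Fin.last n)) (fun k => x k.castSucc) = x := by
  funext k
  induction k using Fin.lastCases with
  | last => exact withTopRow_last _ _
  | cast j => exact withTopRow_castSucc _ _ j

/-- The density is positive on the open set of strict patterns, which contains the array of critical
points. -/
theorem cornersLowerMeasure_univ_ne_zero {n : ℕ} (β : ℝ) {y : Fin (n + 1) → ℝ}
    (hy : StrictMono y) : cornersLowerMeasure β y Set.univ ≠ 0 := by
  rw [cornersLowerMeasure_eq, withDensity_apply _ MeasurableSet.univ, Measure.restrict_univ]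
  intro h0
  rw [lintegral_eq_zero_iff (measurable_strictDensity β y)] at h0
  obtain ⟨xt, ht⟩ := exists_criticalRows y hy
  have hopen : IsOpen {x : LowerRows n | StrictPattern (withTopRow y x)} :=
    (isOpen_strictPattern n).preimage (continuous_withTopRow y)
  have hne : {x : LowerRows n | StrictPattern (withTopRow y x)}.Nonempty := by
    refine ⟨fun k => xt k.castSucc, ?_⟩
    have h : withTopRow y (fun k => xt k.castSucc : LowerRows n) = xt :=
      ht.last ▸ withTopRow_eta xt
    change StrictPattern (withTopRow y (fun k => xt k.castSucc : LowerRows n))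
    rw [h]
    exact ht.strict
  refine (hopen.measure_pos volume hne).ne' (measure_mono_null (fun x hx => ?_) h0)
  intro h1
  have h2 : strictDensity β y x = 0 := h1
  rw [strictDensity, Set.indicator_of_mem hx] at h2
  have hx' : StrictPattern (withTopRow y x) := hx
  exact (ENNReal.ofReal_pos.2 (hx'.cornersWeight_pos β)).ne' h2

theorem cornersLowerMeasure_univ_ne_top {n : ℕ} {β : ℝ} (hβ : 0 < β) {y : Fin (n + 1) → ℝ}
    (hy : StrictMono y) : cornersLowerMeasure β y Set.univ ≠ ⊤ := by
  rw [cornersLowerMeasure_eq, withDensity_apply _ MeasurableSet.univ, Measure.restrict_univ]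
  obtain ⟨K, _, hK⟩ := exists_lintegral_strictDensity_le n hβ
  exact ((hK y hy).trans_lt ENNReal.ofReal_lt_top).ne

theorem isProbabilityMeasure_normalize_map {α γ : Type*} [MeasurableSpace α] [MeasurableSpace γ]
    {μ : Measure α} (h0 : μ Set.univ ≠ 0) (htop : μ Set.univ ≠ ⊤) {f : α → γ}
    (hf : Measurable f) : IsProbabilityMeasure (((μ Set.univ)⁻¹ • μ).map f) := by
  constructor
  rw [Measure.map_apply hf MeasurableSet.univ, Set.preimage_univ, Measure.smul_apply,
    smul_eq_mul, ENNReal.inv_mul_cancel h0 htop]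

theorem isProbabilityMeasure_betaCorners {n : ℕ} {β : ℝ} (hβ : 0 < β) {y : Fin (n + 1) → ℝ}
    (hy : StrictMono y) : IsProbabilityMeasure (betaCorners β y) :=
  isProbabilityMeasure_normalize_map (cornersLowerMeasure_univ_ne_zero β hy)
    (cornersLowerMeasure_univ_ne_top hβ hy) (measurable_withTopRow y)

/-! ### Second-order expansion of the potential -/

open Topology in
/-- The punctured second-order expansion `f t = A t + Q t ^ 2 + o(t ^ 2)` at zero. -/
def HasExpansion (f : ℝ → ℝ) (A Q : ℝ) : Prop :=
  Tendsto (fun t => (f t - A * t) / t ^ 2) (𝓝[≠] 0) (𝓝 Q)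

namespace HasExpansion

open Topology

variable {f g : ℝ → ℝ} {A B Q R : ℝ}

theorem sub (hf : HasExpansion f A Q) (hg : HasExpansion g B R) :
    HasExpansion (fun t => f t - g t) (A - B) (Q - R) := by
  refine (Tendsto.sub hf hg).congr fun t => ?_
  ring

theorem const_mul (c : ℝ) (hf : HasExpansion f A Q) :
    HasExpansion (fun t => c * f t) (c * A) (c * Q) := by
  refine (Tendsto.const_mul c hf).congr fun t => ?_
  ring

theorem sum {ι : Type*} (s : Finset ι) {f : ι → ℝ → ℝ} {A Q : ι → ℝ}
    (h : ∀ i ∈ s, HasExpansion (f i) (A i) (Q i)) :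
    HasExpansion (fun t => ∑ i ∈ s, f i t) (∑ i ∈ s, A i) (∑ i ∈ s, Q i) := by
  refine (tendsto_finsetSum s h).congr fun t => ?_
  rw [Finset.sum_mul, ← Finset.sum_sub_distrib, Finset.sum_div]

theorem log_one_add (r : ℝ) : HasExpansion (fun t => Real.log (1 + t * r)) r (-(r ^ 2 / 2)) := by
  have hsmall : ∀ᶠ t : ℝ in 𝓝[≠] 0, |t * r| ≤ 1 / 2 := by
    have : Tendsto (fun t : ℝ => |t * r|) (𝓝 0) (𝓝 |0 * r|) :=
      Continuous.tendsto (by fun_prop) 0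
    rw [zero_mul, abs_zero] at this
    exact (this.mono_left nhdsWithin_le_nhds).eventually (ge_mem_nhds (by norm_num))
  rw [HasExpansion, tendsto_iff_norm_sub_tendsto_zero]
  have hlim : Tendsto (fun t : ℝ => 2 * |r| ^ 3 * |t|) (𝓝[≠] 0) (𝓝 0) := by
    have : Tendsto (fun t : ℝ => 2 * |r| ^ 3 * |t|) (𝓝 0) (𝓝 (2 * |r| ^ 3 * |0|)) :=
      Continuous.tendsto (by fun_prop) 0
    rw [abs_zero, mul_zero] at this
    exact this.mono_left nhdsWithin_le_nhds
  refine squeeze_zero' (Eventually.of_forall fun _ => norm_nonneg _) ?_ hlim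
  filter_upwards [hsmall, self_mem_nhdsWithin] with t ht ht0
  have ht0' : t ≠ 0 := ht0
  -- Two terms of the Taylor series of the logarithm, with a cubic remainder.
  have h1 := Real.abs_log_sub_add_sum_range_le (x := -(t * r)) (by rw [abs_neg]; linarith) 2
  rw [abs_neg, sub_neg_eq_add] at h1
  have h2 : |t * r| ^ (2 + 1) / (1 - |t * r|) ≤ 2 * |t * r| ^ 3 := by
    rw [div_le_iff₀ (by linarith)]
    have := pow_nonneg (abs_nonneg (t * r)) 3
    change |t * r| ^ 3 ≤ _
    nlinarith
  have h3 : (Real.log (1 + t * r) - r * t) / t ^ 2 - -(r ^ 2 / 2) =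
      ((∑ i ∈ Finset.range 2, (-(t * r)) ^ (i + 1) / ((i : ℝ) + 1)) + Real.log (1 + t * r)) /
        t ^ 2 := by
    simp [Finset.sum_range_succ]
    field_simp
    ring
  rw [h3, Real.norm_eq_abs, abs_div, abs_of_nonneg (sq_nonneg t), div_le_iff₀ (by positivity)]
  refine (h1.trans h2).trans (le_of_eq ?_)
  rw [abs_mul, ← sq_abs t]
  ring

theorem log_abs_add {d : ℝ} (hd : d ≠ 0) (e : ℝ) :
    HasExpansion (fun t => Real.log |d + t * e| - Real.log |d|) (e / d)
      (-((e / d) ^ 2 / 2)) := by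
  refine (log_one_add (e / d)).congr' ?_
  have hne : ∀ᶠ t : ℝ in 𝓝[≠] 0, 1 + t * (e / d) ≠ 0 := by
    have : Tendsto (fun t : ℝ => 1 + t * (e / d)) (𝓝 0) (𝓝 (1 + 0 * (e / d))) :=
      Continuous.tendsto (by fun_prop) 0
    rw [zero_mul, add_zero] at this
    exact (this.mono_left nhdsWithin_le_nhds).eventually_ne one_ne_zero
  filter_upwards [hne] with t ht
  have h : d + t * e = d * (1 + t * (e / d)) := by field_simp
  rw [h, Real.log_abs, Real.log_abs, Real.log_mul hd ht, add_sub_cancel_left]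

theorem tendsto_div_self (hf : HasExpansion f A Q) :
    Tendsto (fun t => f t / t) (𝓝[≠] 0) (𝓝 A) := by
  have h0 : Tendsto (fun t : ℝ => t) (𝓝[≠] 0) (𝓝 0) :=
    tendsto_id.mono_left nhdsWithin_le_nhds
  have h1 := (h0.mul hf).const_add A
  rw [zero_mul, add_zero] at h1
  refine h1.congr' ?_
  filter_upwards [self_mem_nhdsWithin] with t ht
  have ht' : t ≠ 0 := ht
  field_simp
  ring

/-- The quotient f t / t has limit A from both sides, with opposite signs. -/
theorem linear_eq_zero (hf : HasExpansion f A Q) (hle : ∀ᶠ t in 𝓝 0, f t ≤ 0) : A = 0 := by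
  have h := hf.tendsto_div_self
  refine le_antisymm ?_ ?_
  · refine le_of_tendsto (h.mono_left (nhdsGT_le_nhdsNE 0)) ?_
    filter_upwards [hle.filter_mono nhdsWithin_le_nhds, self_mem_nhdsWithin] with t h1 h2
    exact div_nonpos_of_nonpos_of_nonneg h1 (le_of_lt h2)
  · refine ge_of_tendsto (h.mono_left (nhdsLT_le_nhdsNE 0)) ?_
    filter_upwards [hle.filter_mono nhdsWithin_le_nhds, self_mem_nhdsWithin] with t h1 h2
    exact div_nonneg_of_nonpos h1 (le_of_lt h2)

theorem tendsto_div_sq (hf : HasExpansion f A Q) (hle : ∀ᶠ t in 𝓝 0, f t ≤ 0) :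
    Tendsto (fun t => f t / t ^ 2) (𝓝[≠] 0) (𝓝 Q) := by
  have h : HasExpansion f 0 Q := hf.linear_eq_zero hle ▸ hf
  simpa [HasExpansion] using h

end HasExpansion

theorem StrictPattern.cornersWeight_eq_exp {n : ℕ} {x : TriangularArray n}
    (h : StrictPattern x) (β : ℝ) :
    cornersWeight β x = Real.exp ((β / 2 - 1) * logPotential x) := by
  rw [cornersWeight_eq, logPotential, Finset.mul_sum, Real.exp_sum]
  refine Finset.prod_congr rfl fun k _ => ?_
  have h1 : gapPow (2 - β) (x k.castSucc) =
      Real.exp ((2 - β) * logGap (m := k) (x k.castSucc)) := by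
    rw [logGap, Finset.mul_sum, Real.exp_sum]
    refine Finset.prod_congr rfl fun i _ => ?_
    rw [Finset.mul_sum, Real.exp_sum]
    refine Finset.prod_congr rfl fun j hj => ?_
    rw [Real.rpow_def_of_pos (sub_pos.2 ((h k).lower_strictMono (Finset.mem_Ioi.1 hj))), mul_comm]
  have h2 : crossPow (m := k) (β / 2 - 1) (x k.castSucc) (x k.succ) =
      Real.exp ((β / 2 - 1) * logCross (m := k) (x k.castSucc) (x k.succ)) := by
    rw [logCross, Finset.mul_sum, Real.exp_sum]
    refine Finset.prod_congr rfl fun a _ => ?_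
    rw [Finset.mul_sum, Real.exp_sum]
    refine Finset.prod_congr rfl fun b _ => ?_
    rw [Real.rpow_def_of_pos (abs_pos.2 (sub_ne_zero.2 ((h k).ne a b))), mul_comm]
  rw [h1, h2, ← Real.exp_add]
  congr 1
  ring

/-- The linear coefficient need not be computed: maximality at the critical array forces it to
vanish. The factor 2 compensates the limit 1/2 of (β/2 - 1) / β. -/
theorem StrictPattern.hasExpansion_logPotential {n : ℕ} {x : TriangularArray n}
    (h : StrictPattern x) (ξ : TriangularArray n) :
    ∃ A, HasExpansion (fun t => logPotential (x + t • ξ) - logPotential x) A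
      (2 * gffExponent x ξ) := by
  have hrow : ∀ k : Fin n, ∃ A, HasExpansion (fun t =>
      (∑ a : Fin (k + 1), ∑ b : Fin (k + 2),
        (Real.log |(x k.castSucc a - x k.succ b) + t * (ξ k.castSucc a - ξ k.succ b)| -
          Real.log |x k.castSucc a - x k.succ b|)) -
      2 * ∑ i : Fin (k + 1), ∑ j ∈ Finset.Ioi i,
        (Real.log |(x k.castSucc j - x k.castSucc i) + t * (ξ k.castSucc j - ξ k.castSucc i)| -
          Real.log |x k.castSucc j - x k.castSucc i|)) A
      ((∑ a : Fin (k + 1), ∑ b : Fin (k + 2),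
        -(((ξ k.castSucc a - ξ k.succ b) / (x k.castSucc a - x k.succ b)) ^ 2 / 2)) -
      2 * ∑ i : Fin (k + 1), ∑ j ∈ Finset.Ioi i,
        -(((ξ k.castSucc j - ξ k.castSucc i) / (x k.castSucc j - x k.castSucc i)) ^ 2 / 2)) := by
    intro k
    refine ⟨_, HasExpansion.sub (HasExpansion.sum _ fun a _ => HasExpansion.sum _ fun b _ =>
      HasExpansion.log_abs_add (sub_ne_zero.2 ((h k).ne a b)) _) (HasExpansion.const_mul 2
      (HasExpansion.sum _ fun i _ => HasExpansion.sum _ fun j hj =>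
        HasExpansion.log_abs_add (sub_ne_zero.2
          ((h k).lower_strictMono (Finset.mem_Ioi.1 hj)).ne') _))⟩
  choose A hA using hrow
  refine ⟨∑ k, A k, ?_⟩
  convert HasExpansion.sum Finset.univ fun k _ => hA k using 1
  · funext t
    rw [logPotential, logPotential, ← Finset.sum_sub_distrib]
    refine Finset.sum_congr rfl fun k _ => ?_
    simp only [Finset.sum_sub_distrib, logCross, logGap, Pi.add_apply, Pi.smul_apply, smul_eq_mul,
      Real.log_abs]
    have e : ∀ p q r s : ℝ, p + t * r - (q + t * s) = p - q + t * (r - s) := fun p q r s => by ring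
    simp only [e]
    ring
  · rw [gffExponent, Finset.mul_sum]
    refine Finset.sum_congr rfl fun k _ => ?_
    rw [mul_sub, sub_eq_add_neg, add_comm, sub_eq_add_neg]
    congr 1
    · rw [Finset.mul_sum, ← Finset.sum_neg_distrib]
      refine Finset.sum_congr rfl fun a _ => ?_
      rw [Finset.mul_sum, ← Finset.sum_neg_distrib]
      refine Finset.sum_congr rfl fun b _ => ?_
      generalize ξ k.castSucc a - ξ k.succ b = p
      generalize x k.castSucc a - x k.succ b = q
      ring
    · rw [Finset.mul_sum, Finset.mul_sum, ← Finset.sum_neg_distrib]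
      refine Finset.sum_congr rfl fun i _ => ?_
      rw [Finset.mul_sum, Finset.mul_sum, ← Finset.sum_neg_distrib]
      refine Finset.sum_congr rfl fun j _ => ?_
      rw [← neg_sub (ξ k.castSucc j), ← neg_sub (x k.castSucc j), neg_sq, neg_sq]
      generalize ξ k.castSucc j - ξ k.castSucc i = p
      generalize x k.castSucc j - x k.castSucc i = q
      ring

/-! ### Expectations in rescaled coordinates -/

/-- The rows of an array below its top row. -/
def lowerRows {n : ℕ} (x : TriangularArray n) : LowerRows n := fun k => x k.castSucc

theorem withTopRow_add_smul {n : ℕ} (xt : TriangularArray n) (t : ℝ) (ξ : LowerRows n) :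
    withTopRow (n := n) (xt (Fin.last n)) (lowerRows xt + t • ξ) =
      xt + t • withTopRow 0 ξ := by
  funext k
  induction k using Fin.lastCases with
  | last =>
    refine (withTopRow_last _ _).trans ?_
    change xt (Fin.last n) = xt (Fin.last n) + t • withTopRow 0 ξ (Fin.last n)
    rw [withTopRow_last, smul_zero, add_zero]
  | cast j =>
    rw [withTopRow_castSucc, Pi.add_apply, Pi.smul_apply, Pi.add_apply, Pi.smul_apply,
      withTopRow_castSucc]
    rfl

/-- The density of the `β`-corners process in the coordinates `ξ` with `x = xt + β ^ (-1/2) ξ`,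
relative to its value at the array `xt`. -/
noncomputable def rescaledDensity {n : ℕ} (xt : TriangularArray n) (β : ℝ) (ξ : LowerRows n) : ℝ :=
  {ξ : LowerRows n | StrictPattern (xt + (√β)⁻¹ • withTopRow 0 ξ)}.indicator
    (fun ξ => Real.exp ((β / 2 - 1) *
      (logPotential (xt + (√β)⁻¹ • withTopRow 0 ξ) - logPotential xt))) ξ

theorem rescaledDensity_nonneg {n : ℕ} (xt : TriangularArray n) (β : ℝ) (ξ : LowerRows n) :
    0 ≤ rescaledDensity xt β ξ :=
  Set.indicator_nonneg (fun _ _ => (Real.exp_pos _).le) ξ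

theorem measurable_logPotential (n : ℕ) :
    Measurable (logPotential : TriangularArray n → ℝ) := by
  unfold logPotential logCross logGap
  fun_prop

theorem measurable_rescaledDensity {n : ℕ} (xt : TriangularArray n) (β : ℝ) :
    Measurable (rescaledDensity xt β) := by
  have h : Measurable fun ξ : LowerRows n => xt + (√β)⁻¹ • withTopRow 0 ξ :=
    ((measurable_withTopRow 0).const_smul (√β)⁻¹).const_add xt
  refine Measurable.indicator ?_ ((isOpen_strictPattern n).measurableSet.preimage h)
  exact ((((measurable_logPotential n).comp h).sub_const _).const_mul _).exp

section Integrals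

variable {n : ℕ}

theorem integral_normalize_map {α γ : Type*} [MeasurableSpace α] [MeasurableSpace γ]
    (μ : Measure α) {f : α → γ} (hf : Measurable f) {F : γ → ℝ} (hF : Measurable F) :
    ∫ z, F z ∂(((μ Set.univ)⁻¹ • μ).map f) = (∫ x, F (f x) ∂μ) / ∫ _x, (1 : ℝ) ∂μ := by
  rw [integral_map hf.aemeasurable hF.aestronglyMeasurable, integral_smul_measure, integral_const,
    ENNReal.toReal_inv, smul_eq_mul, smul_eq_mul, mul_one, Measure.real]
  ring

theorem integral_betaCorners (β : ℝ) (y : Fin (n + 1) → ℝ) {F : TriangularArray n → ℝ}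
    (hF : Measurable F) : ∫ z, F z ∂(betaCorners β y) =
      (∫ x, (strictDensity β y x).toReal * F (withTopRow y x)) /
        ∫ x, (strictDensity β y x).toReal := by
  rw [betaCorners, integral_normalize_map _ (measurable_withTopRow y) hF, cornersLowerMeasure_eq]
  have hfin : ∀ᵐ x : LowerRows n, strictDensity β y x < ⊤ := by
    refine Eventually.of_forall fun x => ?_
    refine lt_of_le_of_lt (Set.indicator_le_self _ _ x) ENNReal.ofReal_lt_top
  rw [integral_withDensity_eq_integral_toReal_smul (measurable_strictDensity β y) hfin,
    integral_withDensity_eq_integral_toReal_smul (measurable_strictDensity β y) hfin]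
  simp

theorem toReal_strictDensity {y : Fin (n + 1) → ℝ} {xt : TriangularArray n}
    (hl : xt (Fin.last n) = y) {β : ℝ} (ξ : LowerRows n) :
    (strictDensity β y (lowerRows xt + (√β)⁻¹ • ξ)).toReal =
      Real.exp ((β / 2 - 1) * logPotential xt) * rescaledDensity xt β ξ := by
  have e := withTopRow_add_smul xt (√β)⁻¹ ξ
  rw [hl] at e
  by_cases h : StrictPattern (xt + (√β)⁻¹ • withTopRow 0 ξ)
  · rw [strictDensity, rescaledDensity, Set.indicator_of_mem (by
      change StrictPattern (withTopRow y _)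
      rwa [e]), Set.indicator_of_mem (by exact h), e, h.cornersWeight_eq_exp,
      ENNReal.toReal_ofReal (Real.exp_pos _).le, ← Real.exp_add]
    congr 1
    ring
  · rw [strictDensity, rescaledDensity, Set.indicator_of_notMem (by
      change ¬ StrictPattern (withTopRow y _)
      rwa [e]), Set.indicator_of_notMem (by exact h)]
    simp

theorem integral_eq_pow_mul_integral_comp {E : Type*} [NormedAddCommGroup E] [NormedSpace ℝ E]
    [MeasurableSpace E] [BorelSpace E] [FiniteDimensional ℝ E] (μ : Measure E)
    [μ.IsAddHaarMeasure] (h : E → ℝ) (z : E) {t : ℝ} (ht : 0 < t) :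
    ∫ x, h x ∂μ = t ^ Module.finrank ℝ E * ∫ ξ, h (z + t • ξ) ∂μ := by
  rw [Measure.integral_comp_smul_of_nonneg μ (fun x => h (z + x)) t (hR := ht.le),
    integral_add_left_eq_self, smul_eq_mul, mul_inv_cancel_left₀ (by positivity)]

/-- The Jacobian of the rescaling and the value of the density at `xt` appear in numerator and
denominator, and cancel. -/
theorem integral_betaCorners_eq {y : Fin (n + 1) → ℝ} {xt : TriangularArray n}
    (hl : xt (Fin.last n) = y) {β : ℝ} (hβ : 0 < β) {F : TriangularArray n → ℝ}
    (hF : Measurable F) : ∫ z, F z ∂(betaCorners β y) =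
      (∫ ξ, rescaledDensity xt β ξ * F (xt + (√β)⁻¹ • withTopRow 0 ξ)) /
        ∫ ξ, rescaledDensity xt β ξ := by
  have ht : 0 < (√β)⁻¹ := inv_pos.2 (Real.sqrt_pos.2 hβ)
  rw [integral_betaCorners β y hF,
    integral_eq_pow_mul_integral_comp volume _ (lowerRows xt) ht,
    integral_eq_pow_mul_integral_comp volume (fun x => (strictDensity β y x).toReal)
      (lowerRows xt) ht]
  have e := withTopRow_add_smul xt (√β)⁻¹
  rw [hl] at e
  simp only [toReal_strictDensity hl, e, mul_assoc]
  rw [integral_const_mul, integral_const_mul, ← mul_assoc, ← mul_assoc,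
    mul_div_mul_left _ _ (by positivity)]

theorem gffWeight_pos (xt : TriangularArray n) (ξ : LowerRows n) : 0 < gffWeight xt ξ :=
  Real.exp_pos _

theorem measurable_gffWeight (xt : TriangularArray n) : Measurable (gffWeight xt) := by
  have h : Measurable (gffExponent xt) := by
    unfold gffExponent
    fun_prop
  exact (h.comp (measurable_withTopRow 0)).exp

theorem integral_discreteGFF (xt : TriangularArray n) {F : TriangularArray n → ℝ}
    (hF : Measurable F) : ∫ z, F z ∂(discreteGFF xt) =
      (∫ ξ, gffWeight xt ξ * F (withTopRow 0 ξ)) / ∫ ξ, gffWeight xt ξ := by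
  have hfin : ∀ᵐ ξ : LowerRows n, ENNReal.ofReal (gffWeight xt ξ) < ⊤ :=
    Eventually.of_forall fun _ => ENNReal.ofReal_lt_top
  rw [discreteGFF, integral_normalize_map _ (measurable_withTopRow 0) hF, gffLowerMeasure,
    integral_withDensity_eq_integral_toReal_smul (measurable_gffWeight xt).ennreal_ofReal hfin,
    integral_withDensity_eq_integral_toReal_smul (measurable_gffWeight xt).ennreal_ofReal hfin]
  simp [ENNReal.toReal_ofReal (gffWeight_pos xt _).le]

theorem integrable_exp_neg_sum_sq {c : ℝ} (hc : 0 < c) :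
    Integrable (fun ξ : LowerRows n => Real.exp (-(c * ∑ k, ∑ i, ξ k i ^ 2))) volume := by
  have h1 : ∀ k : Fin n, Integrable (fun v : Fin (k + 1) → ℝ => ∏ i, Real.exp (-c * v i ^ 2))
      volume := fun k => Integrable.fintype_prod fun _ => integrable_exp_neg_mul_sq hc
  have h2 : Integrable (fun ξ : LowerRows n => ∏ k, ∏ i, Real.exp (-c * ξ k i ^ 2)) volume :=
    Integrable.fintype_prod_dep h1
  convert h2 using 2 with ξ
  simp_rw [← Real.exp_sum, ← Finset.mul_sum, neg_mul]

end Integrals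

/-! ### Laplace's method -/

section Laplace

open Topology

variable {n : ℕ} {y : Fin (n + 1) → ℝ} {xt : TriangularArray n}

theorem CriticalRows.exists_rescaledDensity_le (ht : CriticalRows y xt) (hy : StrictMono y) :
    ∃ c > 0, ∀ β : ℝ, 4 ≤ β → ∀ ξ : LowerRows n,
      rescaledDensity xt β ξ ≤ Real.exp (-(c * ∑ k, ∑ i, ξ k i ^ 2)) := by
  obtain ⟨c, hc, hle⟩ := ht.exists_logPotential_sub_le hy
  refine ⟨c / 4, by positivity, fun β hβ ξ => ?_⟩
  refine Set.indicator_apply_le' (fun h => Real.exp_le_exp.2 ?_) fun _ => (Real.exp_pos _).le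
  have hl : (xt + (√β)⁻¹ • withTopRow 0 ξ : TriangularArray n) (Fin.last n) = y := by
    rw [Pi.add_apply, Pi.smul_apply, withTopRow_last, smul_zero, add_zero, ht.last]
  have h1 := hle _ h hl
  have h2 : ∀ (k : Fin n) (i : Fin (k + 1)), ((xt + (√β)⁻¹ • withTopRow 0 ξ) k.castSucc i -
      xt k.castSucc i) ^ 2 = β⁻¹ * ξ k i ^ 2 := by
    intro k i
    rw [Pi.add_apply, Pi.smul_apply, withTopRow_castSucc, Pi.add_apply, Pi.smul_apply,
      add_sub_cancel_left, smul_eq_mul, mul_pow, inv_pow, Real.sq_sqrt (by linarith)]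
  simp_rw [h2, ← Finset.mul_sum] at h1
  set S : ℝ := ∑ k, ∑ i, ξ k i ^ 2 with hS
  have hS0 : 0 ≤ S := Finset.sum_nonneg fun _ _ => Finset.sum_nonneg fun _ _ => sq_nonneg _
  have h3 : 0 ≤ β / 2 - 1 := by linarith
  refine (mul_le_mul_of_nonneg_left h1 h3).trans ?_
  -- The condition β ≥ 4 enters here; the rate of the dominating Gaussian does not depend on β.
  have h4 : (1 : ℝ) / 4 ≤ (β / 2 - 1) * β⁻¹ := by
    rw [← div_eq_mul_inv, le_div_iff₀ (by linarith)]
    linarith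
  have h5 := mul_le_mul_of_nonneg_left h4 (mul_nonneg hc.le hS0)
  linarith

theorem tendsto_inv_sqrt_atTop : Tendsto (fun β : ℝ => (√β)⁻¹) atTop (𝓝[≠] 0) := by
  have h : Tendsto (fun β : ℝ => (√β)⁻¹) atTop (𝓝[>] 0) :=
    tendsto_inv_atTop_nhdsGT_zero.comp Real.tendsto_sqrt_atTop
  exact h.mono_right (nhdsGT_le_nhdsNE 0)

theorem tendsto_add_inv_sqrt_smul (x ξ : TriangularArray n) :
    Tendsto (fun β : ℝ => x + (√β)⁻¹ • ξ) atTop (𝓝 x) := by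
  have h : Tendsto (fun β : ℝ => (√β)⁻¹) atTop (𝓝 0) :=
    tendsto_inv_sqrt_atTop.mono_right nhdsWithin_le_nhds
  simpa using (h.smul_const ξ).const_add x

/-- For fixed ξ the indicator is eventually one, since strict patterns form an open set, and the
second-order expansion along the ray in direction ξ gives the limit of the exponent. -/
theorem CriticalRows.tendsto_rescaledDensity (ht : CriticalRows y xt) (hy : StrictMono y)
    (ξ : LowerRows n) :
    Tendsto (fun β => rescaledDensity xt β ξ) atTop (𝓝 (gffWeight xt ξ)) := by
  obtain ⟨c, hc, hle⟩ := ht.exists_logPotential_sub_le hy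
  have hstrict : ∀ᶠ t : ℝ in 𝓝 0, StrictPattern (xt + t • withTopRow 0 ξ) := by
    have hcont : Tendsto (fun t : ℝ => xt + t • withTopRow 0 ξ) (𝓝 0) (𝓝 xt) := by
      have : Tendsto (fun t : ℝ => xt + t • withTopRow 0 ξ) (𝓝 0)
          (𝓝 (xt + (0 : ℝ) • withTopRow 0 ξ)) := Continuous.tendsto (by fun_prop) 0
      rwa [zero_smul, add_zero] at this
    exact hcont.eventually ((isOpen_strictPattern n).mem_nhds ht.strict)
  have hnonpos : ∀ᶠ t : ℝ in 𝓝 0,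
      logPotential (xt + t • withTopRow 0 ξ) - logPotential xt ≤ 0 := by
    filter_upwards [hstrict] with t h
    have hl : (xt + t • withTopRow 0 ξ : TriangularArray n) (Fin.last n) = y := by
      rw [Pi.add_apply, Pi.smul_apply, withTopRow_last, smul_zero, add_zero, ht.last]
    refine (hle _ h hl).trans (neg_nonpos.2 (mul_nonneg hc.le ?_))
    exact Finset.sum_nonneg fun _ _ => Finset.sum_nonneg fun _ _ => sq_nonneg _
  obtain ⟨A, hA⟩ := ht.strict.hasExpansion_logPotential (withTopRow 0 ξ)
  have h1 := (hA.tendsto_div_sq hnonpos).comp tendsto_inv_sqrt_atTop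
  have h2 : Tendsto (fun β : ℝ => 1 / 2 - β⁻¹) atTop (𝓝 (1 / 2 - 0)) :=
    tendsto_inv_atTop_zero.const_sub _
  have h3 := (h2.mul h1).rexp
  have hlim : (1 / 2 - 0) * (2 * gffExponent xt (withTopRow 0 ξ)) =
      gffExponent xt (withTopRow 0 ξ) := by ring
  rw [hlim] at h3
  refine h3.congr' ?_
  filter_upwards [(tendsto_inv_sqrt_atTop.mono_right nhdsWithin_le_nhds).eventually hstrict,
    eventually_gt_atTop 0] with β hβ hβ0
  rw [rescaledDensity, Set.indicator_of_mem (by exact hβ)]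
  congr 1
  simp only [Function.comp_apply]
  rw [inv_pow, Real.sq_sqrt hβ0.le]
  field_simp

/-- The pointwise limit inherits the Gaussian bound, so the quadratic form needs no separate proof
of definiteness. -/
theorem CriticalRows.integrable_gffWeight (ht : CriticalRows y xt) (hy : StrictMono y) :
    Integrable (gffWeight xt) volume := by
  obtain ⟨c, hc, hle⟩ := ht.exists_rescaledDensity_le hy
  refine (integrable_exp_neg_sum_sq hc).mono' (measurable_gffWeight xt).aestronglyMeasurable
    (Eventually.of_forall fun ξ => ?_)
  rw [Real.norm_of_nonneg (gffWeight_pos xt ξ).le]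
  refine le_of_tendsto (ht.tendsto_rescaledDensity hy ξ) ?_
  filter_upwards [eventually_ge_atTop 4] with β hβ using hle β hβ ξ

theorem CriticalRows.integral_gffWeight_pos (ht : CriticalRows y xt) (hy : StrictMono y) :
    0 < ∫ ξ, gffWeight xt ξ :=
  integral_exp_pos (ht.integrable_gffWeight hy)

theorem CriticalRows.isProbabilityMeasure_discreteGFF (ht : CriticalRows y xt)
    (hy : StrictMono y) : IsProbabilityMeasure (discreteGFF xt) := by
  have h : gffLowerMeasure xt Set.univ = ENNReal.ofReal (∫ ξ, gffWeight xt ξ) := by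
    rw [gffLowerMeasure, withDensity_apply _ MeasurableSet.univ, Measure.restrict_univ,
      ofReal_integral_eq_lintegral_ofReal (ht.integrable_gffWeight hy)
        (Eventually.of_forall fun ξ => (gffWeight_pos xt ξ).le)]
  refine isProbabilityMeasure_normalize_map ?_ ?_ (measurable_withTopRow 0)
  · rw [h]
    exact (ENNReal.ofReal_pos.2 (ht.integral_gffWeight_pos hy)).ne'
  · rw [h]
    exact ENNReal.ofReal_ne_top

theorem CriticalRows.tendsto_integral_rescaledDensity (ht : CriticalRows y xt)
    (hy : StrictMono y) {G : ℝ → LowerRows n → ℝ} {G' : LowerRows n → ℝ} {M : ℝ}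
    (hG : ∀ β, Measurable (G β)) (hM : ∀ β ξ, |G β ξ| ≤ M)
    (hlim : ∀ ξ, Tendsto (fun β => G β ξ) atTop (𝓝 (G' ξ))) :
    Tendsto (fun β => ∫ ξ, rescaledDensity xt β ξ * G β ξ) atTop
      (𝓝 (∫ ξ, gffWeight xt ξ * G' ξ)) := by
  obtain ⟨c, hc, hle⟩ := ht.exists_rescaledDensity_le hy
  refine tendsto_integral_filter_of_dominated_convergence
    (fun ξ => Real.exp (-(c * ∑ k, ∑ i, ξ k i ^ 2)) * M)
    (Eventually.of_forall fun β =>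
      ((measurable_rescaledDensity xt β).mul (hG β)).aestronglyMeasurable) ?_
    ((integrable_exp_neg_sum_sq hc).mul_const M)
    (Eventually.of_forall fun ξ => (ht.tendsto_rescaledDensity hy ξ).mul (hlim ξ))
  filter_upwards [eventually_ge_atTop 4] with β hβ
  refine Eventually.of_forall fun ξ => ?_
  rw [norm_mul, Real.norm_of_nonneg (rescaledDensity_nonneg xt β ξ), Real.norm_eq_abs]
  exact mul_le_mul (hle β hβ ξ) (hM β ξ) (abs_nonneg _) (Real.exp_pos _).le

theorem CriticalRows.tendsto_integral_betaCorners (ht : CriticalRows y xt) (hy : StrictMono y)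
    {F : ℝ → TriangularArray n → ℝ} {G' : LowerRows n → ℝ} {M : ℝ}
    (hF : ∀ β, Measurable (F β)) (hM : ∀ β x, |F β x| ≤ M)
    (hlim : ∀ ξ, Tendsto (fun β => F β (xt + (√β)⁻¹ • withTopRow 0 ξ)) atTop (𝓝 (G' ξ))) :
    Tendsto (fun β => ∫ x, F β x ∂(betaCorners β y)) atTop
      (𝓝 ((∫ ξ, gffWeight xt ξ * G' ξ) / ∫ ξ, gffWeight xt ξ)) := by
  -- The constant test function gives the limit of the normalizing integrals.
  have h1 := ht.tendsto_integral_rescaledDensity hy (M := 1) (G := fun _ _ => 1)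
    (G' := fun _ => 1) (fun _ => measurable_const) (by simp) (fun _ => tendsto_const_nhds)
  simp only [mul_one] at h1
  have hmeas : ∀ β : ℝ, Measurable fun ξ : LowerRows n => xt + (√β)⁻¹ • withTopRow 0 ξ :=
    fun β => ((measurable_withTopRow 0).const_smul (√β)⁻¹).const_add xt
  have h2 := ht.tendsto_integral_rescaledDensity hy
    (G := fun β ξ => F β (xt + (√β)⁻¹ • withTopRow 0 ξ))
    (fun β => (hF β).comp (hmeas β)) (fun β ξ => hM β _) hlim
  refine (h2.div h1 (ht.integral_gffWeight_pos hy).ne').congr' ?_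
  filter_upwards [eventually_gt_atTop 0] with β hβ
  exact (integral_betaCorners_eq ht.last hβ (hF β)).symm

end Laplace

/-! ### Convergence in distribution -/

theorem tendsto_val_Ioi_atTop (a : ℝ) :
    Tendsto (fun β : Set.Ioi a => (β : ℝ)) atTop atTop :=
  tendsto_comp_val_Ioi_atTop.2 tendsto_id

/-- Letting the map `g` depend on β covers both limits of the theorem: the array itself and its
rescaled fluctuations. -/
theorem CriticalRows.tendstoInDistribution {n : ℕ} {y : Fin (n + 1) → ℝ}
    {xt : TriangularArray n} (ht : CriticalRows y xt) (hy : StrictMono y)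
    {Ω : Set.Ioi (0 : ℝ) → Type*} [∀ β, MeasurableSpace (Ω β)]
    {P : ∀ β, Measure (Ω β)} [∀ β, IsProbabilityMeasure (P β)]
    {X : ∀ β, Ω β → TriangularArray n} (hX : ∀ β, HasLaw (X β) (betaCorners β y) (P β))
    {Ω' : Type*} [MeasurableSpace Ω'] {Q : Measure Ω'} [IsProbabilityMeasure Q]
    {ξ : Ω' → TriangularArray n} (hξ : HasLaw ξ (discreteGFF xt) Q)
    {g : ℝ → TriangularArray n → TriangularArray n} (hg : ∀ β, Measurable (g β))
    {g' : TriangularArray n → TriangularArray n} (hg' : Measurable g')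
    (hlim : ∀ η : LowerRows n, Tendsto (fun β => g β (xt + (√β)⁻¹ • withTopRow 0 η)) atTop
      (nhds (g' (withTopRow 0 η)))) :
    TendstoInDistribution (fun (β : Set.Ioi (0 : ℝ)) ω => g β (X β ω)) atTop
      (fun ω => g' (ξ ω)) P Q where
  forall_aemeasurable β := (hg β).comp_aemeasurable (hX β).aemeasurable
  aemeasurable_limit := hg'.comp_aemeasurable hξ.aemeasurable
  tendsto := by
    refine ProbabilityMeasure.tendsto_iff_forall_integral_tendsto.2 fun f => ?_
    have hf : Measurable f := f.continuous.measurable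
    have h1 : ∀ β : Set.Ioi (0 : ℝ), ∫ z, f z ∂((P β).map fun ω => g β (X β ω)) =
        ∫ x, f (g β x) ∂(betaCorners β y) := by
      intro β
      rw [integral_map (φ := fun ω => g β (X β ω))
        ((hg β).comp_aemeasurable (hX β).aemeasurable) hf.aestronglyMeasurable,
        ← (hX β).map_eq, integral_map (f := fun x => f (g β x)) (hX β).aemeasurable
          (hf.comp (hg β)).aestronglyMeasurable]
    have h2 : ∫ z, f z ∂(Q.map fun ω => g' (ξ ω)) = ∫ x, f (g' x) ∂(discreteGFF xt) := by
      rw [integral_map (φ := fun ω => g' (ξ ω)) (hg'.comp_aemeasurable hξ.aemeasurable)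
        hf.aestronglyMeasurable,
        ← hξ.map_eq, integral_map (f := fun x => f (g' x)) hξ.aemeasurable
          (hf.comp hg').aestronglyMeasurable]
    have h3 := ht.tendsto_integral_betaCorners hy (F := fun β x => f (g β x)) (M := ‖f‖)
      (fun β => hf.comp (hg β)) (fun β x => f.norm_coe_le_norm _)
      (fun η => (f.continuous.tendsto _).comp (hlim η))
    rw [← integral_discreteGFF xt (F := fun x => f (g' x)) (hf.comp hg')] at h3
    simp only [ProbabilityMeasure.coe_mk, h1, h2]
    exact h3.comp (tendsto_val_Ioi_atTop 0)

theorem theorem3 {n : ℕ} (y : Fin (n + 1) → ℝ) (hy : StrictMono y) :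
    -- the `β`-corners process with top row `y` is well defined
    (∀ β : ℝ, 0 < β → IsProbabilityMeasure (betaCorners β y)) ∧
    -- the deterministic part of the `∞`-corners process is well defined
    (∃! x : TriangularArray n, IsInfinityCorners y x) ∧
    ∀ x : TriangularArray n, IsInfinityCorners y x →
      -- the Gaussian density is integrable, so that the Gaussian field is well defined
      Integrable (gffWeight x) volume ∧
      IsProbabilityMeasure (discreteGFF x) ∧
      -- convergence in distribution of the whole array, and of its rescaled fluctuations
      ∀ (Ω : Set.Ioi (0 : ℝ) → Type*) [∀ β, MeasurableSpace (Ω β)]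
        (P : ∀ β, Measure (Ω β)) [∀ β, IsProbabilityMeasure (P β)]
        (X : ∀ β, Ω β → TriangularArray n)
        (_ : ∀ β, HasLaw (X β) (betaCorners β y) (P β))
        (Ω' : Type*) [MeasurableSpace Ω'] (Q : Measure Ω') [IsProbabilityMeasure Q]
        (ξ : Ω' → TriangularArray n) (_ : HasLaw ξ (discreteGFF x) Q),
        TendstoInDistribution X atTop (fun _ => x) P Q ∧
        TendstoInDistribution (fun (β : Set.Ioi (0 : ℝ)) ω => Real.sqrt (β : ℝ) • (X β ω - x)) atTop ξ P Q := by
  refine ⟨fun β hβ => isProbabilityMeasure_betaCorners hβ hy, existsUnique_isInfinityCorners y hy,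
    fun x hx => ?_⟩
  have ht := hx.criticalRows hy
  refine ⟨ht.integrable_gffWeight hy, ht.isProbabilityMeasure_discreteGFF hy, ?_⟩
  intro Ω _ P _ X hX Ω' _ Q _ ξ hξ
  constructor
  · exact ht.tendstoInDistribution hy hX hξ (g := fun _ z => z) (g' := fun _ => x)
      (fun _ => measurable_id) measurable_const fun η => tendsto_add_inv_sqrt_smul x _
  · refine ht.tendstoInDistribution hy hX hξ (g := fun β z => √β • (z - x)) (g' := fun z => z)
      (fun β => (measurable_id.sub_const x).const_smul √β) measurable_id fun η => ?_
    -- The fluctuation map inverts the rescaling exactly for β > 0, so the sequence is eventually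
    -- constant.
    refine tendsto_const_nhds.congr' ?_
    filter_upwards [eventually_gt_atTop 0] with β hβ
    rw [add_sub_cancel_left, smul_inv_smul₀ (Real.sqrt_pos.2 hβ).ne']
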